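/- Let $m\ge 1$, let $\mathbb D$ be the open unit disc, $\mathbb T$ the unit circle, and let $H^2_m$ be the vector Hardy space of power series $f(t)=\sum_{n\ge0}a_nt^n$ with $a_n\in\mathbb C^m$ and $\|f\|^2=\sum_n\|a_n\|^2<\infty$. Let $F\in H^\infty_{m\times m}$, i.e. $F$ is an $m\times m$ matrix function on $\mathbb D$ with bounded analytic entries, and let $T_F:H^2_m\to H^2_m$, $(T_Fg)(t)=F(t)g(t)$, be the analytic vector Toeplitz operator with symbol $F$. **Definitions.** A bounded operator $S$ on a complex Hilbert space $H$ is *subnormal* if it has a normal extension, i.e. if there are a Hilbert space $K\supset H$ and a bounded normal operator $N$ on $K$ with $NH\subset H$ and $S=N|_H$. It is *pure* if it has no non-zero closed invariant subspace on which it is normal. A subnormal operator is *of finite type* if it is pure and its self-commutator $S^*S-SS^*$ has finite rank. $S$ *has no point masses* if it has a normal extension $N$ with no (non-zero) eigenvectors. The class $\mathrm{NDARN}_m$ consists of the $m\times m$ matrix functions $F$ on $\mathbb D$ that are analytic (bounded and analytic on $\mathbb D$), rational, normal (for almost every $t\in\mathbb T$ the boundary value $F(t)$, the radial limit, is defined and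 is a normal matrix), and non-degenerate (for every constant $c\in\mathbb C$, the determinant $\det(F(t)-cI)$ is not identically zero on $\mathbb D$). **Statement.** $T_F$ is a subnormal operator of finite type without point masses if and only if $F\in\mathrm{NDARN}_m$. -/

import Mathlib

open scoped Matrix InnerProductSpace ENNReal Nat Topology
open Filter MeasureTheory

noncomputable section

/-! ### Subnormal operators -/

section Subnormal

universe u

variable {H : Type u} [NormedAddCommGroup H] [InnerProductSpace ℂ H]

/-- `N : K → K` is a normal extension of `S : H → H`, where `H` is regarded as a closed subspace
of the Hilbert space `K` through the isometric embedding `J`. -/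
def IsNormalExtension (S : H →L[ℂ] H) {K : Type u} [NormedAddCommGroup K]
    [InnerProductSpace ℂ K] [CompleteSpace K] (J : H →ₗᵢ[ℂ] K) (N : K →L[ℂ] K) : Prop :=
  IsStarNormal N ∧ ∀ x : H, N (J x) = J (S x)

/-- `S` is subnormal: it has a normal extension. -/
def IsSubnormal (S : H →L[ℂ] H) : Prop :=
  ∃ (K : Type u) (_ : NormedAddCommGroup K) (_ : InnerProductSpace ℂ K) (_ : CompleteSpace K)
    (J : H →ₗᵢ[ℂ] K) (N : K →L[ℂ] K), IsNormalExtension S J N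

/-- `S` has no point masses: it has a normal extension without (non-zero) eigenvectors. -/
def HasNoPointMasses (S : H →L[ℂ] H) : Prop :=
  ∃ (K : Type u) (_ : NormedAddCommGroup K) (_ : InnerProductSpace ℂ K) (_ : CompleteSpace K)
    (J : H →ₗᵢ[ℂ] K) (N : K →L[ℂ] K), IsNormalExtension S J N ∧
      ∀ (c : ℂ) (x : K), N x = c • x → x = 0

/-- `S` is pure: it has no non-zero (closed) invariant subspace `L` on which it is normal.
Here `N` is the restriction of `S` to `L`, as an operator on the Hilbert space `L`. -/
def IsPure (S : H →L[ℂ] H) : Prop :=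
  ∀ (L : Submodule ℂ H) [CompleteSpace L] (N : L →L[ℂ] L),
    (∀ x : L, (N x : H) = S x) → IsStarNormal N → L = ⊥

/-- The self-commutator `S* S - S S*`. -/
def selfCommutator [CompleteSpace H] (S : H →L[ℂ] H) : H →L[ℂ] H :=
  ContinuousLinearMap.adjoint S ∘L S - S ∘L ContinuousLinearMap.adjoint S

/-- `S` is a subnormal operator of finite type: it is subnormal and pure, and its self-commutator
has finite rank. -/
structure IsSubnormalOfFiniteType [CompleteSpace H] (S : H →L[ℂ] H) : Prop where
  subnormal : IsSubnormal S
  pure : IsPure S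
  finiteRank : FiniteDimensional ℂ (LinearMap.range (selfCommutator S : H →ₗ[ℂ] H))

end Subnormal

/-! ### Classes of matrix functions on the unit disc

A matrix function on the open unit disc is a function `F : ℂ → Matrix (Fin m) (Fin m) ℂ`, of which
only the values on the disc `Metric.ball 0 1` are used. -/

section MatrixFunctions

variable {m : ℕ}

/-- `F ∈ H^∞_{m×m}`: every entry is analytic and bounded on the open unit disc. -/
def IsHInf (F : ℂ → Matrix (Fin m) (Fin m) ℂ) : Prop :=
  ∀ i j, DifferentiableOn ℂ (fun z => F z i j) (Metric.ball 0 1) ∧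
    ∃ B : ℝ, ∀ z ∈ Metric.ball (0 : ℂ) 1, ‖F z i j‖ ≤ B

/-- `F` is rational: on the disc every entry is a quotient of two polynomials, away from the zeros
of the denominator. -/
def IsRationalMatrix (F : ℂ → Matrix (Fin m) (Fin m) ℂ) : Prop :=
  ∀ i j, ∃ p q : Polynomial ℂ, q ≠ 0 ∧
    ∀ z ∈ Metric.ball (0 : ℂ) 1, q.eval z ≠ 0 → F z i j = p.eval z / q.eval z

/-- `F` is normal: for almost every point `t = e^{iθ}` of the unit circle the boundary value
`F(t)`, that is, the radial limit of `F` at `t`, is defined and is a normal matrix. -/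
def IsNormalMatrix (F : ℂ → Matrix (Fin m) (Fin m) ℂ) : Prop :=
  ∀ᵐ θ : ℝ, ∃ A : Matrix (Fin m) (Fin m) ℂ,
    Tendsto (fun r : ℝ => F (r * Complex.exp (θ * Complex.I))) (𝓝[<] 1) (𝓝 A) ∧ IsStarNormal A

/-- `F` is non-degenerate: for no constant `c` does `det (F(t) - c I)` vanish identically on the
disc. -/
def IsNondegenerate (F : ℂ → Matrix (Fin m) (Fin m) ℂ) : Prop :=
  ∀ c : ℂ, ∃ z ∈ Metric.ball (0 : ℂ) 1, (F z - c • (1 : Matrix (Fin m) (Fin m) ℂ)).det ≠ 0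

/-- The class `NDARN_m` of non-degenerate analytic rational normal `m × m` matrix functions. -/
structure IsNDARN (F : ℂ → Matrix (Fin m) (Fin m) ℂ) : Prop where
  nondegenerate : IsNondegenerate F
  analytic : IsHInf F
  rational : IsRationalMatrix F
  normal : IsNormalMatrix F

end MatrixFunctions

/-! ### The vector Hardy space -/

/-- The vector Hardy space `H²_m` of power series `∑ aₙ tⁿ`, `aₙ ∈ ℂ^m`, `∑ ‖aₙ‖² < ∞`: the element
of `H²_m` with Taylor coefficients `aₙ` is the square summable sequence `n ↦ aₙ`. -/
abbrev HardyTwo (m : ℕ) : Type := lp (fun _ : ℕ => EuclideanSpace ℂ (Fin m)) 2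

/-- The value `f(t) = ∑ aₙ tⁿ` of `f ∈ H²_m` at a point `t` of the unit disc. -/
def HardyTwo.eval {m : ℕ} (f : HardyTwo m) (t : ℂ) : EuclideanSpace ℂ (Fin m) :=
  ∑' n : ℕ, t ^ n • f n

/-- The `n`-th Taylor coefficient at the origin. -/
def taylorCoeff {m : ℕ} (g : ℂ → EuclideanSpace ℂ (Fin m)) (n : ℕ) : EuclideanSpace ℂ (Fin m) :=
  (n ! : ℂ)⁻¹ • iteratedDeriv n g 0

/-- The function `t ↦ F(t) f(t)` on the disc. -/
def mulSymbol {m : ℕ} (F : ℂ → Matrix (Fin m) (Fin m) ℂ) (f : HardyTwo m) (t : ℂ) :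
    EuclideanSpace ℂ (Fin m) :=
  WithLp.toLp 2 (F t *ᵥ (f.eval t).ofLp)

section Toeplitz

variable {m : ℕ}

lemma HardyTwo.norm_coeff_le (f : HardyTwo m) (n : ℕ) : ‖f n‖ ≤ ‖f‖ :=
  lp.norm_apply_le_norm (by simp) f n

lemma HardyTwo.summable_eval (f : HardyTwo m) {t : ℂ} (ht : t ∈ Metric.ball (0 : ℂ) 1) :
    Summable fun n : ℕ => t ^ n • f n := by
  have ht' : ‖t‖ < 1 := by simpa using ht
  refine Summable.of_norm_bounded
    ((summable_geometric_of_lt_one (norm_nonneg t) ht').mul_right ‖f‖) fun n => ?_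
  rw [norm_smul, norm_pow]
  exact mul_le_mul_of_nonneg_left (f.norm_coeff_le n) (by positivity)

lemma HardyTwo.hasSum_eval (f : HardyTwo m) {t : ℂ} (ht : t ∈ Metric.ball (0 : ℂ) 1) :
    HasSum (fun n : ℕ => t ^ n • f n) (f.eval t) :=
  (f.summable_eval ht).hasSum

lemma HardyTwo.differentiableOn_eval (f : HardyTwo m) :
    DifferentiableOn ℂ f.eval (Metric.ball 0 1) := by
  intro t ht
  have ht' : ‖t‖ < 1 := by simpa using ht
  obtain ⟨r, hr1, hr2⟩ := exists_between ht'
  have hr0 : 0 ≤ r := (norm_nonneg t).trans hr1.le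
  have hd : DifferentiableOn ℂ (fun w : ℂ => ∑' n : ℕ, w ^ n • f n) (Metric.ball 0 r) := by
    refine Complex.differentiableOn_tsum_of_summable_norm
      (u := fun n : ℕ => r ^ n * ‖f‖)
      ((summable_geometric_of_lt_one hr0 hr2).mul_right _) ?_ Metric.isOpen_ball ?_
    · intro n
      fun_prop
    · intro n w hw
      have hw' : ‖w‖ < r := by simpa using hw
      rw [norm_smul, norm_pow]
      gcongr
      exact f.norm_coeff_le n
  exact ((hd t (by simpa using hr1)).differentiableAt
    (Metric.isOpen_ball.mem_nhds (by simpa using hr1))).differentiableWithinAt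

lemma differentiableOn_mulSymbol {F : ℂ → Matrix (Fin m) (Fin m) ℂ} (hF : IsHInf F)
    (f : HardyTwo m) : DifferentiableOn ℂ (mulSymbol F f) (Metric.ball 0 1) := by
  rw [differentiableOn_euclidean]
  intro i
  simp only [mulSymbol, Matrix.mulVec, dotProduct]
  refine DifferentiableOn.fun_sum fun j _ => ?_
  exact (hF i j).1.mul ((differentiableOn_euclidean.1 f.differentiableOn_eval) j)

lemma hasSum_taylorCoeff {g : ℂ → EuclideanSpace ℂ (Fin m)}
    (hg : DifferentiableOn ℂ g (Metric.ball 0 1)) {t : ℂ} (ht : t ∈ Metric.ball (0 : ℂ) 1) :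
    HasSum (fun n => t ^ n • taylorCoeff g n) (g t) := by
  have h := Complex.hasSum_taylorSeries_on_ball hg ht
  simp only [sub_zero] at h
  refine h.congr_fun ?_
  intro n
  simp only [taylorCoeff]
  rw [smul_comm]

lemma fact_two_pi_pos : Fact (0 < 2 * Real.pi) := ⟨Real.two_pi_pos⟩

attribute [local instance] fact_two_pi_pos

/-- Parseval's identity for an absolutely convergent trigonometric series. -/
lemma parseval_scalar {c : ℕ → ℂ} (hc : Summable fun n => ‖c n‖)
    {u : AddCircle (2 * Real.pi) → ℂ} (hu : ∀ θ, HasSum (fun n : ℕ => c n * fourier n θ) (u θ)) :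
    Continuous u ∧ HasSum (fun n => ‖c n‖ ^ 2) (∫ θ, ‖u θ‖ ^ 2 ∂AddCircle.haarAddCircle) := by
  have hs : Summable fun n : ℕ => c n • (fourier n : C(AddCircle (2 * Real.pi), ℂ)) := by
    refine Summable.of_norm_bounded hc fun n => ?_
    rw [norm_smul, fourier_norm, mul_one]
  obtain ⟨U, hU⟩ := hs
  have hUu : ∀ θ, U θ = u θ := fun θ => by
    have h1 := (ContinuousMap.evalCLM ℂ θ).hasSum hU
    simp only [ContinuousMap.evalCLM_apply, ContinuousMap.smul_apply,
      smul_eq_mul] at h1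
    exact h1.unique (hu θ)
  have hUu' : (U : AddCircle (2 * Real.pi) → ℂ) = u := funext hUu
  refine ⟨hUu' ▸ U.continuous, ?_⟩
  let P := ContinuousMap.toLp (E := ℂ) 2 (AddCircle.haarAddCircle (T := 2 * Real.pi)) ℂ
  have h2 : HasSum (fun n : ℕ => c n • fourierLp (T := 2 * Real.pi) 2 (n : ℤ)) (P U) := by
    simpa [Function.comp_def, P, fourierLp] using P.hasSum hU
  have horth : Orthonormal ℂ (fun n : ℕ => fourierLp (T := 2 * Real.pi) 2 (n : ℤ)) :=
    orthonormal_fourier.comp _ Nat.cast_injective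
  have h3 : ‖P U‖ ^ 2 = ∫ θ, ‖u θ‖ ^ 2 ∂AddCircle.haarAddCircle := by
    have h4 := ContinuousMap.inner_toLp (𝕜 := ℂ)
      (AddCircle.haarAddCircle (T := 2 * Real.pi)) U U
    have h5 : ((‖P U‖ ^ 2 : ℝ) : ℂ) =
        ((∫ θ, ‖u θ‖ ^ 2 ∂AddCircle.haarAddCircle : ℝ) : ℂ) := by
      rw [← integral_complex_ofReal]
      have h6 := inner_self_eq_norm_sq_to_K (𝕜 := ℂ) (P U)
      rw [h4] at h6
      push_cast
      rw [← show ((‖P U‖ : ℂ)) ^ 2 = _ from rfl]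
      refine h6.symm.trans (integral_congr_ae (Eventually.of_forall fun θ => ?_))
      simp only [hUu]
      rw [← Complex.mul_conj']
    exact_mod_cast h5
  rw [← h3]
  have h7 : Tendsto (fun s : Finset ℕ =>
      ‖∑ n ∈ s, c n • fourierLp (T := 2 * Real.pi) 2 (n : ℤ)‖ ^ 2) atTop (𝓝 (‖P U‖ ^ 2)) :=
    (Filter.Tendsto.norm h2).pow 2
  refine h7.congr fun s => ?_
  have h8 := horth.inner_sum c c s
  rw [inner_self_eq_norm_sq_to_K] at h8
  have h9 : ((‖∑ n ∈ s, c n • fourierLp (T := 2 * Real.pi) 2 (n : ℤ)‖ ^ 2 : ℝ) : ℂ) =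
      ((∑ n ∈ s, ‖c n‖ ^ 2 : ℝ) : ℂ) := by
    push_cast
    refine h8.trans (Finset.sum_congr rfl fun n _ => ?_)
    rw [← Complex.conj_mul']
  exact_mod_cast h9

/-- The point `r e^{iθ}` of the circle of radius `r`. -/
def circlePt (r : ℝ) (θ : AddCircle (2 * Real.pi)) : ℂ := r * fourier 1 θ

lemma norm_circlePt {r : ℝ} (hr : 0 ≤ r) (θ : AddCircle (2 * Real.pi)) : ‖circlePt r θ‖ = r := by
  rw [circlePt, norm_mul, Complex.norm_real, Real.norm_of_nonneg hr, fourier_apply,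
    Circle.norm_coe, mul_one]

lemma circlePt_pow (r : ℝ) (θ : AddCircle (2 * Real.pi)) (n : ℕ) :
    circlePt r θ ^ n = (r : ℂ) ^ n * fourier n θ := by
  rw [circlePt, mul_pow]
  congr 1
  induction n with
  | zero => simp
  | succ k ih => rw [pow_succ, ih]; push_cast; rw [fourier_add]

/-- Parseval's identity for a vector valued power series on the circle of radius `r`. -/
lemma parseval_vector {c : ℕ → EuclideanSpace ℂ (Fin m)} {u : ℂ → EuclideanSpace ℂ (Fin m)}
    (hu : ∀ z ∈ Metric.ball (0 : ℂ) 1, HasSum (fun n => z ^ n • c n) (u z))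
    {r : ℝ} (hr0 : 0 < r) (hr1 : r < 1) :
    Continuous (fun θ => u (circlePt r θ)) ∧
      HasSum (fun n => (r ^ n) ^ 2 * ‖c n‖ ^ 2)
        (∫ θ, ‖u (circlePt r θ)‖ ^ 2 ∂AddCircle.haarAddCircle) := by
  have hrb : (r : ℂ) ∈ Metric.ball (0 : ℂ) 1 := by simpa [abs_of_pos hr0] using hr1
  have key : ∀ i : Fin m, Continuous (fun θ => u (circlePt r θ) i) ∧
      HasSum (fun n => ‖(r : ℂ) ^ n * c n i‖ ^ 2)
        (∫ θ, ‖u (circlePt r θ) i‖ ^ 2 ∂AddCircle.haarAddCircle) := by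
    intro i
    have hcoord : ∀ z ∈ Metric.ball (0 : ℂ) 1, HasSum (fun n => z ^ n * c n i) (u z i) := by
      intro z hz
      simpa using (EuclideanSpace.proj (𝕜 := ℂ) i).hasSum (hu z hz)
    refine parseval_scalar (c := fun n => (r : ℂ) ^ n * c n i) ?_ fun θ => ?_
    · exact (hcoord r hrb).summable.norm
    · have hz : circlePt r θ ∈ Metric.ball (0 : ℂ) 1 := by
        simpa [norm_circlePt hr0.le] using hr1
      refine (hcoord _ hz).congr_fun fun n => ?_
      rw [circlePt_pow]; ring
  have hcont : Continuous (fun θ => u (circlePt r θ)) := by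
    have h1 : Continuous fun θ => (u (circlePt r θ)).ofLp := continuous_pi fun i => (key i).1
    exact (PiLp.continuous_toLp 2 _).comp h1
  refine ⟨hcont, ?_⟩
  have hsum := hasSum_sum (s := Finset.univ) fun (i : Fin m) _ => (key i).2
  rw [← integral_finsetSum] at hsum
  · simp only [EuclideanSpace.norm_sq_eq]
    refine hsum.congr_fun fun n => ?_
    rw [Finset.mul_sum]
    refine Finset.sum_congr rfl fun i _ => ?_
    rw [norm_mul, mul_pow, norm_pow, Complex.norm_real, Real.norm_eq_abs, abs_of_pos hr0]
  · intro i _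
    exact ((key i).1.norm.pow 2).integrable_of_hasCompactSupport
      (HasCompactSupport.of_compactSpace _)

/-- A bounded symbol acts on vectors with a uniform bound on the disc. -/
lemma exists_bound_mulVec {F : ℂ → Matrix (Fin m) (Fin m) ℂ} (hF : IsHInf F) :
    ∃ C : ℝ, 0 ≤ C ∧ ∀ z ∈ Metric.ball (0 : ℂ) 1, ∀ v : EuclideanSpace ℂ (Fin m),
      ‖(WithLp.toLp 2 (F z *ᵥ v.ofLp) : EuclideanSpace ℂ (Fin m))‖ ≤ C * ‖v‖ := by
  choose B hB using fun i j => (hF i j).2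
  refine ⟨∑ i, ∑ j, |B i j|, by positivity, fun z hz v => ?_⟩
  have h1 : (WithLp.toLp 2 (F z *ᵥ v.ofLp) : EuclideanSpace ℂ (Fin m)) =
      ∑ i, EuclideanSpace.single i ((F z *ᵥ v.ofLp) i) := by
    ext k
    simp [Finset.sum_apply, Pi.single_apply]
  rw [h1, Finset.sum_mul]
  refine (norm_sum_le _ _).trans (Finset.sum_le_sum fun i _ => ?_)
  rw [PiLp.norm_single, Finset.sum_mul, Matrix.mulVec, dotProduct]
  refine (norm_sum_le _ _).trans (Finset.sum_le_sum fun j _ => ?_)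
  rw [norm_mul]
  exact mul_le_mul ((hB i j z hz).trans (le_abs_self _)) (PiLp.norm_apply_le v j)
    (norm_nonneg _) (abs_nonneg _)

lemma sum_taylorCoeff_le {F : ℂ → Matrix (Fin m) (Fin m) ℂ} (hF : IsHInf F) {C : ℝ}
    (hb : ∀ z ∈ Metric.ball (0 : ℂ) 1, ∀ v : EuclideanSpace ℂ (Fin m),
      ‖(WithLp.toLp 2 (F z *ᵥ v.ofLp) : EuclideanSpace ℂ (Fin m))‖ ≤ C * ‖v‖)
    (f : HardyTwo m) (s : Finset ℕ) :
    ∑ n ∈ s, ‖taylorCoeff (mulSymbol F f) n‖ ^ 2 ≤ (C * ‖f‖) ^ 2 := by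
  have hf2 : HasSum (fun n => ‖f n‖ ^ 2) (‖f‖ ^ 2) := by
    simpa using lp.hasSum_norm (p := 2) (by simp) f
  have step : ∀ r : ℝ, 0 < r → r < 1 →
      ∑ n ∈ s, (r ^ n) ^ 2 * ‖taylorCoeff (mulSymbol F f) n‖ ^ 2 ≤ (C * ‖f‖) ^ 2 := by
    intro r hr0 hr1
    obtain ⟨hgc, hg⟩ := parseval_vector
      (fun z hz => hasSum_taylorCoeff (differentiableOn_mulSymbol hF f) hz) hr0 hr1
    obtain ⟨hfc, hfs⟩ := parseval_vector (fun z hz => f.hasSum_eval hz) hr0 hr1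
    refine (sum_le_hasSum s (fun n _ => by positivity) hg).trans ?_
    have h1 : (∫ θ, ‖mulSymbol F f (circlePt r θ)‖ ^ 2 ∂AddCircle.haarAddCircle) ≤
        ∫ θ, C ^ 2 * ‖f.eval (circlePt r θ)‖ ^ 2 ∂AddCircle.haarAddCircle := by
      refine integral_mono ?_ ?_ fun θ => ?_
      · exact (hgc.norm.pow 2).integrable_of_hasCompactSupport
          (HasCompactSupport.of_compactSpace _)
      · exact (continuous_const.mul (hfc.norm.pow 2)).integrable_of_hasCompactSupport
          (HasCompactSupport.of_compactSpace _)
      · have hz : circlePt r θ ∈ Metric.ball (0 : ℂ) 1 := by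
          simpa [norm_circlePt hr0.le] using hr1
        simp only [← mul_pow]
        exact pow_le_pow_left₀ (norm_nonneg _) (hb _ hz _) 2
    refine h1.trans ?_
    rw [integral_const_mul, mul_pow]
    refine mul_le_mul_of_nonneg_left (hasSum_le (fun n => ?_) hfs hf2) (by positivity)
    exact mul_le_of_le_one_left (by positivity)
      (pow_le_one₀ (by positivity) (pow_le_one₀ hr0.le hr1.le))
  have hlim : Tendsto (fun r : ℝ => ∑ n ∈ s, (r ^ n) ^ 2 * ‖taylorCoeff (mulSymbol F f) n‖ ^ 2)
      (𝓝[<] 1) (𝓝 (∑ n ∈ s, ‖taylorCoeff (mulSymbol F f) n‖ ^ 2)) := by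
    have hc : Continuous fun r : ℝ =>
        ∑ n ∈ s, (r ^ n) ^ 2 * ‖taylorCoeff (mulSymbol F f) n‖ ^ 2 := by fun_prop
    have := (hc.tendsto 1).mono_left (nhdsWithin_le_nhds (s := Set.Iio (1 : ℝ)))
    simpa using this
  refine le_of_tendsto hlim ?_
  filter_upwards [Ioo_mem_nhdsLT (show (0 : ℝ) < 1 by norm_num)] with r hr
  exact step r hr.1 hr.2

lemma memLp_taylorCoeff {F : ℂ → Matrix (Fin m) (Fin m) ℂ} (hF : IsHInf F) (f : HardyTwo m) :
    Memℓp (fun n => taylorCoeff (mulSymbol F f) n) 2 := by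
  obtain ⟨C, hC, hb⟩ := exists_bound_mulVec hF
  refine memℓp_gen' (C := (C * ‖f‖) ^ 2) fun s => ?_
  simpa using sum_taylorCoeff_le hF hb f s

lemma contDiffAt_mulSymbol {F : ℂ → Matrix (Fin m) (Fin m) ℂ} (hF : IsHInf F) (f : HardyTwo m)
    (n : ℕ) : ContDiffAt ℂ n (mulSymbol F f) 0 :=
  ((differentiableOn_mulSymbol hF f).analyticAt
    (Metric.isOpen_ball.mem_nhds (by simp))).contDiffAt

lemma mulSymbol_add (F : ℂ → Matrix (Fin m) (Fin m) ℂ) (f g : HardyTwo m) {t : ℂ}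
    (ht : t ∈ Metric.ball (0 : ℂ) 1) :
    mulSymbol F (f + g) t = mulSymbol F f t + mulSymbol F g t := by
  have h : (f + g).eval t = f.eval t + g.eval t := by
    have h1 := (f.hasSum_eval ht).add (g.hasSum_eval ht)
    refine ((f + g).hasSum_eval ht).unique (h1.congr_fun fun n => ?_)
    simp
  simp [mulSymbol, h, Matrix.mulVec_add]

lemma mulSymbol_smul (F : ℂ → Matrix (Fin m) (Fin m) ℂ) (c : ℂ) (f : HardyTwo m) {t : ℂ}
    (ht : t ∈ Metric.ball (0 : ℂ) 1) :
    mulSymbol F (c • f) t = c • mulSymbol F f t := by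
  have h : (c • f).eval t = c • f.eval t := by
    have h1 := (f.hasSum_eval ht).const_smul c
    refine ((c • f).hasSum_eval ht).unique (h1.congr_fun fun n => ?_)
    simp [smul_comm c]
  simp [mulSymbol, h, Matrix.mulVec_smul]

/-- The analytic vector Toeplitz operator `T_F` on `H²_m` with symbol `F ∈ H^∞_{m×m}`: the operator
`f ↦ F f` of multiplication by `F`. -/
def toeplitz (F : ℂ → Matrix (Fin m) (Fin m) ℂ) (hF : IsHInf F) : HardyTwo m →L[ℂ] HardyTwo m :=
  LinearMap.mkContinuousOfExistsBound
    { toFun := fun f => ⟨fun n => taylorCoeff (mulSymbol F f) n, memLp_taylorCoeff hF f⟩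
      map_add' := fun f g => by
        ext1
        funext n
        have h : mulSymbol F (f + g) =ᶠ[𝓝 0] mulSymbol F f + mulSymbol F g := by
          filter_upwards [Metric.isOpen_ball.mem_nhds
            (show (0 : ℂ) ∈ Metric.ball (0 : ℂ) 1 by simp)] with t ht
          exact mulSymbol_add F f g ht
        simp only [taylorCoeff, lp.coeFn_add, Pi.add_apply]
        rw [h.iteratedDeriv_eq, iteratedDeriv_add (contDiffAt_mulSymbol hF f n)
          (contDiffAt_mulSymbol hF g n), smul_add]
      map_smul' := fun c f => by
        ext1
        funext n
        have h : mulSymbol F (c • f) =ᶠ[𝓝 0] c • mulSymbol F f := by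
          filter_upwards [Metric.isOpen_ball.mem_nhds
            (show (0 : ℂ) ∈ Metric.ball (0 : ℂ) 1 by simp)] with t ht
          exact mulSymbol_smul F c f ht
        simp only [taylorCoeff, lp.coeFn_smul, Pi.smul_apply, RingHom.id_apply]
        rw [h.iteratedDeriv_eq, iteratedDeriv_const_smul (contDiffAt_mulSymbol hF f n),
          smul_comm] }
    (by
      obtain ⟨C, hC, hb⟩ := exists_bound_mulVec hF
      refine ⟨C, fun f => lp.norm_le_of_forall_sum_le (by simp) (by positivity) fun s => ?_⟩
      simpa using sum_taylorCoeff_le hF hb f s)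

/-- `(T_F f)(t) = F(t) f(t)` on the disc. -/
theorem toeplitz_eval (F : ℂ → Matrix (Fin m) (Fin m) ℂ) (hF : IsHInf F) (f : HardyTwo m) {t : ℂ}
    (ht : t ∈ Metric.ball (0 : ℂ) 1) :
    (toeplitz F hF f).eval t = WithLp.toLp 2 (F t *ᵥ (f.eval t).ofLp) :=
  ((toeplitz F hF f).hasSum_eval ht).unique
    (hasSum_taylorCoeff (differentiableOn_mulSymbol hF f) ht)

end Toeplitz

end

noncomputable section

/-! ### Power series on the disc -/

section PowerSeries

variable {m : ℕ}

attribute [local instance] fact_two_pi_pos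

/-- The coefficients of a vector valued power series on the unit disc are determined by its sum. -/
lemma eq_of_hasSum_powerSeries {c d : ℕ → EuclideanSpace ℂ (Fin m)}
    {u : ℂ → EuclideanSpace ℂ (Fin m)}
    (hc : ∀ z ∈ Metric.ball (0 : ℂ) 1, HasSum (fun n => z ^ n • c n) (u z))
    (hd : ∀ z ∈ Metric.ball (0 : ℂ) 1, HasSum (fun n => z ^ n • d n) (u z)) : c = d := by
  have h0 : ∀ z ∈ Metric.ball (0 : ℂ) 1,
      HasSum (fun n => z ^ n • (c n - d n)) ((fun _ => 0 : ℂ → EuclideanSpace ℂ (Fin m)) z) := by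
    intro z hz
    simpa [smul_sub] using (hc z hz).sub (hd z hz)
  obtain ⟨-, h⟩ := parseval_vector h0 (r := 1 / 2) (by norm_num) (by norm_num)
  simp only [norm_zero, ne_eq, OfNat.ofNat_ne_zero, not_false_eq_true, zero_pow,
    integral_zero] at h
  funext n
  have h1 := (hasSum_zero_iff_of_nonneg (fun n => by positivity)).1 h
  have h2 := congrFun h1 n
  simp only [Pi.zero_apply, mul_eq_zero, ne_eq, OfNat.ofNat_ne_zero, not_false_eq_true,
    pow_eq_zero_iff, norm_eq_zero] at h2
  rcases h2 with h2 | h2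
  · exact absurd h2 (by positivity)
  · exact sub_eq_zero.1 h2

lemma HardyTwo.ext_eval {f g : HardyTwo m}
    (h : ∀ z ∈ Metric.ball (0 : ℂ) 1, f.eval z = g.eval z) : f = g := by
  ext1
  exact eq_of_hasSum_powerSeries (fun z hz => f.hasSum_eval hz)
    (fun z hz => by rw [h z hz]; exact g.hasSum_eval hz)

lemma HardyTwo.eval_single (j : ℕ) (v : EuclideanSpace ℂ (Fin m)) (z : ℂ) :
    HardyTwo.eval (lp.single 2 j v) z = z ^ j • v := by
  rw [HardyTwo.eval, tsum_eq_single j]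
  · rw [lp.single_apply_self]
  · intro n hn
    rw [lp.single_apply_ne _ _ _ hn, smul_zero]

lemma HardyTwo.eval_add (f g : HardyTwo m) {t : ℂ} (ht : t ∈ Metric.ball (0 : ℂ) 1) :
    (f + g).eval t = f.eval t + g.eval t := by
  have h1 := (f.hasSum_eval ht).add (g.hasSum_eval ht)
  refine ((f + g).hasSum_eval ht).unique (h1.congr_fun fun n => ?_)
  simp

lemma HardyTwo.eval_smul (c : ℂ) (f : HardyTwo m) {t : ℂ} (ht : t ∈ Metric.ball (0 : ℂ) 1) :
    (c • f).eval t = c • f.eval t := by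
  have h1 := (f.hasSum_eval ht).const_smul c
  refine ((c • f).hasSum_eval ht).unique (h1.congr_fun fun n => ?_)
  simp [smul_comm c]

/-- A continuous linear map on `H²_m` is determined by its values on the monomials. -/
lemma HardyTwo.clm_ext {G : Type*} [NormedAddCommGroup G] [NormedSpace ℂ G]
    {R R' : HardyTwo m →L[ℂ] G}
    (h : ∀ j v, R (lp.single 2 j v) = R' (lp.single 2 j v)) : R = R' := by
  ext f
  have hf := lp.hasSum_single (E := fun _ : ℕ => EuclideanSpace ℂ (Fin m)) (p := 2) (by simp) f
  have h1 := R.hasSum hf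
  have h2 := R'.hasSum hf
  simp only [h] at h1
  exact h1.unique h2

end PowerSeries

/-! ### Matrix of an analytic Toeplitz operator -/

section Coefficients

variable {m : ℕ} {F : ℂ → Matrix (Fin m) (Fin m) ℂ}
  {A : ℕ → EuclideanSpace ℂ (Fin m) →L[ℂ] EuclideanSpace ℂ (Fin m)}

/-- `F(z) = ∑ Aₙ zⁿ` on the disc, as operators on `ℂ^m`. -/
def HasCoeffs (F : ℂ → Matrix (Fin m) (Fin m) ℂ)
    (A : ℕ → EuclideanSpace ℂ (Fin m) →L[ℂ] EuclideanSpace ℂ (Fin m)) : Prop :=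
  ∀ z ∈ Metric.ball (0 : ℂ) 1,
    HasSum (fun n => z ^ n • A n) (Matrix.toEuclideanCLM (n := Fin m) (𝕜 := ℂ) (F z))

/-- `Matrix.toEuclideanCLM` as a continuous linear equivalence. -/
def toEuclideanCLE (m : ℕ) : Matrix (Fin m) (Fin m) ℂ ≃L[ℂ]
    (EuclideanSpace ℂ (Fin m) →L[ℂ] EuclideanSpace ℂ (Fin m)) :=
  LinearEquiv.toContinuousLinearEquiv
    (Matrix.toEuclideanCLM (n := Fin m) (𝕜 := ℂ)).toAlgEquiv.toLinearEquiv

lemma toEuclideanCLE_apply (M : Matrix (Fin m) (Fin m) ℂ) :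
    toEuclideanCLE m M = Matrix.toEuclideanCLM (n := Fin m) (𝕜 := ℂ) M := rfl

lemma hasCoeffs_iff_entry : HasCoeffs F A ↔ ∀ z ∈ Metric.ball (0 : ℂ) 1, ∀ i j,
    HasSum (fun n => z ^ n * (toEuclideanCLE m).symm (A n) i j) (F z i j) := by
  refine forall₂_congr fun z hz => ?_
  rw [← toEuclideanCLE_apply]
  have h1 : HasSum (fun n => z ^ n • A n) (toEuclideanCLE m (F z)) ↔
      HasSum (fun n => z ^ n • (toEuclideanCLE m).symm (A n)) (F z) := by
    refine ((toEuclideanCLE m).symm.hasSum (f := fun n => z ^ n • A n) (y := F z)).symm.trans ?_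
    simp only [map_smul]
  exact h1.trans (Pi.hasSum.trans (forall_congr' fun i => Pi.hasSum))

/-- The Taylor coefficients at the origin of a matrix function. -/
def matrixCoeff (F : ℂ → Matrix (Fin m) (Fin m) ℂ) (n : ℕ) :
    EuclideanSpace ℂ (Fin m) →L[ℂ] EuclideanSpace ℂ (Fin m) :=
  toEuclideanCLE m (Matrix.of fun i j => (n ! : ℂ)⁻¹ * iteratedDeriv n (fun z => F z i j) 0)

lemma IsHInf.hasCoeffs (hF : IsHInf F) : HasCoeffs F (matrixCoeff F) := by
  rw [hasCoeffs_iff_entry]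
  intro z hz i j
  have h := Complex.hasSum_taylorSeries_on_ball (hF i j).1 hz
  refine h.congr_fun fun n => ?_
  simp [matrixCoeff]
  ring

lemma toeplitz_eval_clm (hF : IsHInf F) (f : HardyTwo m) {t : ℂ}
    (ht : t ∈ Metric.ball (0 : ℂ) 1) :
    (toeplitz F hF f).eval t = Matrix.toEuclideanCLM (n := Fin m) (𝕜 := ℂ) (F t) (f.eval t) :=
  toeplitz_eval F hF f ht

lemma toeplitz_single (hF : IsHInf F) (hA : HasCoeffs F A) (j : ℕ) (v : EuclideanSpace ℂ (Fin m))
    (n : ℕ) : toeplitz F hF (lp.single 2 j v) n = if j ≤ n then A (n - j) v else 0 := by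
  refine congrFun (eq_of_hasSum_powerSeries (d := fun n => if j ≤ n then A (n - j) v else 0)
    (fun z hz => (toeplitz F hF (lp.single 2 j v)).hasSum_eval hz) fun z hz => ?_) n
  rw [toeplitz_eval_clm hF _ hz, HardyTwo.eval_single, map_smul]
  rw [← (add_left_injective j).hasSum_iff]
  · have h := ((ContinuousLinearMap.apply ℂ _ v).hasSum (hA z hz)).const_smul (z ^ j)
    refine h.congr_fun fun n => ?_
    simp [pow_add, mul_smul, smul_comm (z ^ n)]
  · intro n hn
    rw [if_neg, smul_zero]
    intro hjn
    exact hn ⟨n - j, Nat.sub_add_cancel hjn⟩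

lemma adjoint_toeplitz_single (hF : IsHInf F) (hA : HasCoeffs F A) (j : ℕ)
    (v : EuclideanSpace ℂ (Fin m)) (l : ℕ) :
    ContinuousLinearMap.adjoint (toeplitz F hF) (lp.single 2 j v) l =
      if l ≤ j then ContinuousLinearMap.adjoint (A (j - l)) v else 0 := by
  refine ext_inner_left ℂ fun (u : EuclideanSpace ℂ (Fin m)) => ?_
  refine (lp.inner_single_left (𝕜 := ℂ) (G := fun _ : ℕ => EuclideanSpace ℂ (Fin m)) l u
    (ContinuousLinearMap.adjoint (toeplitz F hF) (lp.single 2 j v))).symm.trans ?_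
  rw [ContinuousLinearMap.adjoint_inner_right, lp.inner_single_right, toeplitz_single hF hA]
  split_ifs
  · rw [ContinuousLinearMap.adjoint_inner_right]
  · simp

lemma inner_toeplitz_single_add (hF : IsHInf F) (hA : HasCoeffs F A) (j d : ℕ)
    (v w : EuclideanSpace ℂ (Fin m)) :
    ⟪toeplitz F hF (lp.single 2 j v), toeplitz F hF (lp.single 2 (j + d) w)⟫_ℂ =
      ⟪toeplitz F hF (lp.single 2 0 v), toeplitz F hF (lp.single 2 d w)⟫_ℂ := by
  have h1 := lp.hasSum_inner (𝕜 := ℂ) (toeplitz F hF (lp.single 2 j v))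
    (toeplitz F hF (lp.single 2 (j + d) w))
  rw [← (add_left_injective j).hasSum_iff] at h1
  · refine h1.unique ((lp.hasSum_inner (𝕜 := ℂ) _ _).congr_fun fun n => ?_)
    simp only [Function.comp_apply, toeplitz_single hF hA]
    have h2 : j + d ≤ n + j ↔ d ≤ n := by omega
    have h3 : n + j - (j + d) = n - d := by omega
    simp [h2, h3]
  · intro n hn
    rw [toeplitz_single hF hA, if_neg, inner_zero_left]
    intro hjn
    exact hn ⟨n - j, Nat.sub_add_cancel hjn⟩

lemma inner_adjoint_toeplitz_single_add (hF : IsHInf F) (hA : HasCoeffs F A) (j d : ℕ)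
    (v w : EuclideanSpace ℂ (Fin m)) :
    ⟪ContinuousLinearMap.adjoint (toeplitz F hF) (lp.single 2 j v),
      ContinuousLinearMap.adjoint (toeplitz F hF) (lp.single 2 (j + d) w)⟫_ℂ =
      ∑ n ∈ Finset.range (j + 1), ⟪ContinuousLinearMap.adjoint (A n) v,
        ContinuousLinearMap.adjoint (A (n + d)) w⟫_ℂ := by
  rw [lp.inner_eq_tsum, tsum_eq_sum (s := Finset.range (j + 1))]
  · rw [← Finset.sum_flip]
    refine Finset.sum_congr rfl fun l hl => ?_
    have hl' : l ≤ j := Nat.lt_succ_iff.1 (Finset.mem_range.1 hl)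
    rw [adjoint_toeplitz_single hF hA, adjoint_toeplitz_single hF hA,
      if_pos (Nat.sub_le j l), if_pos (by omega), show j - (j - l) = l by omega,
      show j + d - (j - l) = l + d by omega]
  · intro l hl
    rw [adjoint_toeplitz_single hF hA, if_neg, inner_zero_left]
    simpa [Nat.lt_succ_iff] using hl

end Coefficients

/-! ### Consequences of a finite rank self-commutator -/

section FiniteRank

/-- A finite rank operator maps bounded sequences to sequences that annihilate weakly null ones. -/
lemma tendsto_inner_of_finiteRank {H : Type*} [NormedAddCommGroup H] [InnerProductSpace ℂ H]
    {C : H →L[ℂ] H} [FiniteDimensional ℂ (LinearMap.range (C : H →ₗ[ℂ] H))] {x y : ℕ → H} {B : ℝ}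
    (hx : ∀ n, ‖x n‖ ≤ B) (hy : ∀ u : H, Tendsto (fun n => ⟪u, y n⟫_ℂ) atTop (𝓝 0)) :
    Tendsto (fun n => ⟪C (x n), y n⟫_ℂ) atTop (𝓝 0) := by
  set R := LinearMap.range (C : H →ₗ[ℂ] H)
  let b := stdOrthonormalBasis ℂ R
  have hB : 0 ≤ B := (norm_nonneg _).trans (hx 0)
  have key : ∀ n, ⟪C (x n), y n⟫_ℂ = ∑ i, ⟪C (x n), (b i : H)⟫_ℂ * ⟪(b i : H), y n⟫_ℂ := by
    intro n
    have h1 := b.sum_repr' ⟨C (x n), LinearMap.mem_range_self _ (x n)⟩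
    have h2 := congrArg (fun r : R => (r : H)) h1
    simp only [Submodule.coe_sum, Submodule.coe_smul, Submodule.coe_inner] at h2
    conv_lhs => rw [← h2]
    rw [sum_inner]
    refine Finset.sum_congr rfl fun i _ => ?_
    rw [inner_smul_left, inner_conj_symm]
  simp only [key]
  have hz : ∀ i, Tendsto (fun n => ⟪C (x n), (b i : H)⟫_ℂ * ⟪(b i : H), y n⟫_ℂ) atTop (𝓝 0) := by
    intro i
    refine squeeze_zero_norm (a := fun n => ‖C‖ * B * ‖(b i : H)‖ * ‖⟪(b i : H), y n⟫_ℂ‖)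
      (fun n => ?_) ?_
    · rw [norm_mul]
      refine mul_le_mul_of_nonneg_right ((norm_inner_le_norm _ _).trans ?_) (norm_nonneg _)
      refine mul_le_mul_of_nonneg_right ?_ (norm_nonneg _)
      exact (C.le_opNorm _).trans (mul_le_mul_of_nonneg_left (hx n) (norm_nonneg _))
    · simpa using ((hy (b i : H)).norm).const_mul (‖C‖ * B * ‖(b i : H)‖)
  simpa using tendsto_finsetSum Finset.univ fun i _ => hz i

variable {m : ℕ} {F : ℂ → Matrix (Fin m) (Fin m) ℂ}
  {A : ℕ → EuclideanSpace ℂ (Fin m) →L[ℂ] EuclideanSpace ℂ (Fin m)}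

lemma tendsto_inner_single (u : HardyTwo m) (d : ℕ) (w : EuclideanSpace ℂ (Fin m)) :
    Tendsto (fun j : ℕ => ⟪u, (lp.single 2 (j + d) w : HardyTwo m)⟫_ℂ) atTop (𝓝 0) := by
  simp only [lp.inner_single_right]
  have h := (lp.hasSum_inner (𝕜 := ℂ) u u).summable.tendsto_atTop_zero
  have h2 : Tendsto (fun n => ‖u n‖ ^ 2) atTop (𝓝 0) := by
    have := h.norm
    simpa [inner_self_eq_norm_sq_to_K] using this
  have h3 : Tendsto (fun n => ‖u n‖) atTop (𝓝 0) := by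
    have := (Real.continuous_sqrt.tendsto 0).comp h2
    simpa [Function.comp_def, Real.sqrt_sq] using this
  refine squeeze_zero_norm (a := fun j => ‖u (j + d)‖ * ‖w‖) (fun j => norm_inner_le_norm _ _) ?_
  simpa using ((tendsto_add_atTop_iff_nat d).2 h3).mul_const ‖w‖

lemma inner_selfCommutator {H : Type*} [NormedAddCommGroup H] [InnerProductSpace ℂ H]
    [CompleteSpace H] (S : H →L[ℂ] H) (x y : H) :
    ⟪selfCommutator S x, y⟫_ℂ = ⟪S x, S y⟫_ℂ -
      ⟪ContinuousLinearMap.adjoint S x, ContinuousLinearMap.adjoint S y⟫_ℂ := by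
  simp [selfCommutator, ContinuousLinearMap.adjoint_inner_left,
    ContinuousLinearMap.adjoint_inner_right]

/-- The Fourier coefficients of `F(t)* F(t)` and `F(t) F(t)*` agree. -/
def CoeffsNormal (F : ℂ → Matrix (Fin m) (Fin m) ℂ) (hF : IsHInf F)
    (A : ℕ → EuclideanSpace ℂ (Fin m) →L[ℂ] EuclideanSpace ℂ (Fin m)) : Prop :=
  ∀ (d : ℕ) (v w : EuclideanSpace ℂ (Fin m)),
    HasSum (fun n => ⟪ContinuousLinearMap.adjoint (A n) v,
        ContinuousLinearMap.adjoint (A (n + d)) w⟫_ℂ)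
      ⟪toeplitz F hF (lp.single 2 0 v), toeplitz F hF (lp.single 2 d w)⟫_ℂ

lemma sum_norm_adjoint_le (hF : IsHInf F) (hA : HasCoeffs F A) (v : EuclideanSpace ℂ (Fin m))
    (j : ℕ) : ∑ n ∈ Finset.range (j + 1), ‖ContinuousLinearMap.adjoint (A n) v‖ ^ 2 ≤
      (‖ContinuousLinearMap.adjoint (toeplitz F hF)‖ * ‖v‖) ^ 2 := by
  have h := inner_adjoint_toeplitz_single_add hF hA j 0 v v
  simp only [add_zero, inner_self_eq_norm_sq_to_K] at h
  have h' : ‖ContinuousLinearMap.adjoint (toeplitz F hF) (lp.single 2 j v)‖ ^ 2 =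
      ∑ n ∈ Finset.range (j + 1), ‖ContinuousLinearMap.adjoint (A n) v‖ ^ 2 := by exact_mod_cast h
  rw [← h']
  refine pow_le_pow_left₀ (norm_nonneg _) ?_ 2
  refine (ContinuousLinearMap.le_opNorm _ _).trans_eq ?_
  rw [lp.norm_single (by simp)]

lemma summable_norm_adjoint_sq (hF : IsHInf F) (hA : HasCoeffs F A)
    (v : EuclideanSpace ℂ (Fin m)) :
    Summable fun n => ‖ContinuousLinearMap.adjoint (A n) v‖ ^ 2 := by
  refine summable_of_sum_range_le (fun n => by positivity) (c :=
    (‖ContinuousLinearMap.adjoint (toeplitz F hF)‖ * ‖v‖) ^ 2) fun n => ?_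
  refine le_trans ?_ (sum_norm_adjoint_le hF hA v n)
  rw [Finset.sum_range_succ]
  exact le_add_of_nonneg_right (by positivity)

/-- The vector `(A*_{n+j} v)ₙ` of `H²_m`. -/
def tailVector (hF : IsHInf F) (hA : HasCoeffs F A) (j : ℕ) (v : EuclideanSpace ℂ (Fin m)) :
    HardyTwo m :=
  ⟨fun n => ContinuousLinearMap.adjoint (A (n + j)) v, by
    refine memℓp_gen ?_
    simpa using (summable_nat_add_iff j).2 (summable_norm_adjoint_sq hF hA v)⟩

lemma tailVector_apply (hF : IsHInf F) (hA : HasCoeffs F A) (j : ℕ)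
    (v : EuclideanSpace ℂ (Fin m)) (n : ℕ) :
    tailVector hF hA j v n = ContinuousLinearMap.adjoint (A (n + j)) v := rfl

lemma coeffsNormal_of_finiteRank (hF : IsHInf F) (hA : HasCoeffs F A)
    [FiniteDimensional ℂ (LinearMap.range
      (selfCommutator (toeplitz F hF) : HardyTwo m →ₗ[ℂ] HardyTwo m))] :
    CoeffsNormal F hF A := by
  intro d v w
  have hs : Summable fun n => ⟪ContinuousLinearMap.adjoint (A n) v,
        ContinuousLinearMap.adjoint (A (n + d)) w⟫_ℂ := by
    have := lp.summable_inner (𝕜 := ℂ) (tailVector hF hA 0 v) (tailVector hF hA d w)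
    simpa [tailVector_apply] using this
  have h1 := tendsto_inner_of_finiteRank (C := selfCommutator (toeplitz F hF))
    (x := fun j => lp.single 2 j v) (y := fun j => lp.single 2 (j + d) w) (B := ‖v‖)
    (fun j => (lp.norm_single (by simp) _ _).le) (fun u => tendsto_inner_single u d w)
  simp only [inner_selfCommutator, inner_toeplitz_single_add hF hA,
    inner_adjoint_toeplitz_single_add hF hA] at h1
  have h2 := (tendsto_add_atTop_iff_nat 1).2 hs.hasSum.tendsto_sum_nat
  have h3 := tendsto_nhds_unique h1 (h2.const_sub _)
  rw [sub_eq_zero.1 h3.symm]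
  exact hs.hasSum

lemma inner_selfCommutator_single (hF : IsHInf F) (hA : HasCoeffs F A) (hN : CoeffsNormal F hF A)
    (j k : ℕ) (v w : EuclideanSpace ℂ (Fin m)) :
    ⟪selfCommutator (toeplitz F hF) (lp.single 2 j v), (lp.single 2 k w : HardyTwo m)⟫_ℂ =
      ⟪tailVector hF hA (j + 1) v, tailVector hF hA (k + 1) w⟫_ℂ := by
  have main : ∀ (j d : ℕ) (v w : EuclideanSpace ℂ (Fin m)),
      ⟪selfCommutator (toeplitz F hF) (lp.single 2 j v),
        (lp.single 2 (j + d) w : HardyTwo m)⟫_ℂ =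
      ⟪tailVector hF hA (j + 1) v, tailVector hF hA (j + d + 1) w⟫_ℂ := by
    intro j d v w
    rw [inner_selfCommutator, inner_toeplitz_single_add hF hA,
      inner_adjoint_toeplitz_single_add hF hA]
    refine HasSum.unique ?_ (lp.hasSum_inner (𝕜 := ℂ) _ _)
    simp only [tailVector_apply]
    have := (hasSum_nat_add_iff' (j + 1)).2 (hN d v w)
    refine this.congr_fun fun n => ?_
    rw [show n + (j + d + 1) = n + (j + 1) + d by omega]
  rcases le_total j k with h | h
  · obtain ⟨d, rfl⟩ := Nat.exists_eq_add_of_le h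
    exact main j d v w
  · obtain ⟨d, rfl⟩ := Nat.exists_eq_add_of_le h
    have h1 := congrArg (starRingEnd ℂ) (main k d w v)
    rw [inner_conj_symm, inner_conj_symm] at h1
    rw [← h1, inner_selfCommutator, ← inner_conj_symm, ← inner_conj_symm
      (ContinuousLinearMap.adjoint (toeplitz F hF) _), ← map_sub, ← inner_selfCommutator,
      inner_conj_symm]

end FiniteRank

/-! ### Rational matrix functions -/

section Rational

open Polynomial

lemma Polynomial.eventually_eval_ne_zero {q : ℂ[X]} (hq : q ≠ 0) (z : ℂ) :
    ∀ᶠ w in 𝓝[≠] z, q.eval w ≠ 0 := by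
  have h1 : IsClosed ((q.roots.toFinset.erase z : Finset ℂ) : Set ℂ) :=
    (Finset.finite_toSet _).isClosed
  have h2 : ((q.roots.toFinset.erase z : Finset ℂ) : Set ℂ)ᶜ ∈ 𝓝 z := by
    refine h1.isOpen_compl.mem_nhds ?_
    simp
  filter_upwards [mem_nhdsWithin_of_mem_nhds h2, self_mem_nhdsWithin] with w hw hwz h0
  refine hw ?_
  simp only [Finset.coe_erase, Set.mem_sdiff, Finset.mem_coe, Multiset.mem_toFinset,
    Set.mem_singleton_iff]
  exact ⟨(mem_roots hq).2 h0, hwz⟩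

/-- Continuous functions on the disc may be compared after multiplication by a polynomial. -/
lemma eqOn_ball_of_eval_smul_eq {X : Type*} [NormedAddCommGroup X] [NormedSpace ℂ X] {q : ℂ[X]}
    (hq : q ≠ 0) {g h : ℂ → X} (hg : ContinuousOn g (Metric.ball 0 1))
    (hh : ContinuousOn h (Metric.ball 0 1))
    (heq : ∀ z ∈ Metric.ball (0 : ℂ) 1, q.eval z • g z = q.eval z • h z) :
    ∀ z ∈ Metric.ball (0 : ℂ) 1, g z = h z := by
  intro z hz
  have hb := Metric.isOpen_ball.mem_nhds hz
  have h1 : Tendsto g (𝓝[≠] z) (𝓝 (g z)) := (hg.continuousAt hb).tendsto.mono_left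
    nhdsWithin_le_nhds
  have h2 : Tendsto h (𝓝[≠] z) (𝓝 (h z)) := (hh.continuousAt hb).tendsto.mono_left
    nhdsWithin_le_nhds
  refine tendsto_nhds_unique_of_eventuallyEq h1 h2 ?_
  filter_upwards [Polynomial.eventually_eval_ne_zero hq z, mem_nhdsWithin_of_mem_nhds hb]
    with w hw hwb
  exact smul_right_injective X hw (heq w hwb)

lemma Polynomial.eq_zero_of_eval_ball {q : ℂ[X]}
    (h : ∀ z ∈ Metric.ball (0 : ℂ) 1, q.eval z = 0) : q = 0 := by
  by_contra hq
  have h1 := Polynomial.eventually_eval_ne_zero hq 0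
  have h2 : ∀ᶠ w in 𝓝[≠] (0 : ℂ), w ∈ Metric.ball (0 : ℂ) 1 :=
    mem_nhdsWithin_of_mem_nhds (Metric.isOpen_ball.mem_nhds (by simp))
  obtain ⟨w, hw1, hw2⟩ := (h1.and h2).exists
  exact hw1 (h w hw2)

/-- A bounded rational function on the disc has a denominator without zeros on the closed disc. -/
lemma exists_denominator_ne_zero {f : ℂ → ℂ} (hf : ContinuousOn f (Metric.ball 0 1)) {B : ℝ}
    (hB : ∀ z ∈ Metric.ball (0 : ℂ) 1, ‖f z‖ ≤ B) (n : ℕ) :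
    ∀ p q : ℂ[X], q.natDegree = n → q ≠ 0 →
      (∀ z ∈ Metric.ball (0 : ℂ) 1, q.eval z * f z = p.eval z) →
      ∃ p' q' : ℂ[X], (∀ z : ℂ, ‖z‖ ≤ 1 → q'.eval z ≠ 0) ∧
        ∀ z ∈ Metric.ball (0 : ℂ) 1, q'.eval z * f z = p'.eval z := by
  induction n using Nat.strong_induction_on with
  | _ n ih =>
    intro p q hqn hq h
    by_cases hz : ∀ z : ℂ, ‖z‖ ≤ 1 → q.eval z ≠ 0
    · exact ⟨p, q, hz, h⟩
    push Not at hz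
    obtain ⟨z₀, hz₀, hqz⟩ := hz
    have hpz : p.eval z₀ = 0 := by
      have hc : ∀ s : ℂ[X], Tendsto (fun r : ℝ => s.eval ((r : ℂ) * z₀)) (𝓝[<] 1)
          (𝓝 (s.eval z₀)) := by
        intro s
        have : Continuous fun r : ℝ => s.eval ((r : ℂ) * z₀) := by fun_prop
        simpa using (this.tendsto 1).mono_left (nhdsWithin_le_nhds (s := Set.Iio (1 : ℝ)))
      refine tendsto_nhds_unique (hc p) ?_
      refine squeeze_zero_norm' (a := fun r : ℝ => ‖q.eval ((r : ℂ) * z₀)‖ * B) ?_ ?_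
      · filter_upwards [Ioo_mem_nhdsLT (show (0 : ℝ) < 1 by norm_num)] with r hr
        have hrb : (r : ℂ) * z₀ ∈ Metric.ball (0 : ℂ) 1 := by
          simp only [mem_ball_zero_iff, norm_mul, Complex.norm_real, Real.norm_eq_abs,
            abs_of_pos hr.1]
          nlinarith [hr.1, hr.2, norm_nonneg z₀]
        rw [← h _ hrb, norm_mul]
        exact mul_le_mul_of_nonneg_left (hB _ hrb) (norm_nonneg _)
      · have := (hc q).norm.mul_const B
        simpa [hqz] using this
    obtain ⟨q', rfl⟩ := dvd_iff_isRoot.2 hqz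
    obtain ⟨p', rfl⟩ := dvd_iff_isRoot.2 hpz
    have hq' : q' ≠ 0 := right_ne_zero_of_mul hq
    refine ih q'.natDegree ?_ p' q' rfl hq' ?_
    · rw [natDegree_mul (X_sub_C_ne_zero z₀) hq', natDegree_X_sub_C] at hqn
      omega
    · refine eqOn_ball_of_eval_smul_eq (X_sub_C_ne_zero z₀) ?_ ?_ fun z hz => ?_
      · exact q'.continuous.continuousOn.mul hf
      · exact p'.continuous.continuousOn
      · have := h z hz
        simp only [eval_mul, smul_eq_mul] at this ⊢
        rw [← this, mul_assoc]

/-- The Taylor coefficients of a bounded rational function on the disc are absolutely summable. -/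
lemma summable_taylor_of_rational {f : ℂ → ℂ} (hf : DifferentiableOn ℂ f (Metric.ball 0 1))
    {B : ℝ} (hB : ∀ z ∈ Metric.ball (0 : ℂ) 1, ‖f z‖ ≤ B) {p q : ℂ[X]} (hq : q ≠ 0)
    (h : ∀ z ∈ Metric.ball (0 : ℂ) 1, q.eval z * f z = p.eval z) :
    Summable fun n : ℕ => ‖(n ! : ℂ)⁻¹ * iteratedDeriv n f 0‖ := by
  obtain ⟨p', q', hq', h'⟩ := exists_denominator_ne_zero hf.continuousOn hB _ p q rfl hq h
  have hopen : IsOpen {z : ℂ | q'.eval z ≠ 0} := isOpen_ne_fun q'.continuous continuous_const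
  obtain ⟨δ, hδ, hsub⟩ := (isCompact_closedBall (0 : ℂ) 1).exists_thickening_subset_open hopen
    (fun z hz => hq' z (by simpa using hz))
  rw [thickening_closedBall hδ zero_le_one] at hsub
  have hd : DifferentiableOn ℂ (fun z => p'.eval z / q'.eval z) (Metric.ball 0 (δ + 1)) :=
    p'.differentiable.differentiableOn.div q'.differentiable.differentiableOn fun z hz => hsub hz
  have hev : f =ᶠ[𝓝 0] fun z => p'.eval z / q'.eval z := by
    filter_upwards [Metric.isOpen_ball.mem_nhds
      (show (0 : ℂ) ∈ Metric.ball (0 : ℂ) 1 by simp)] with z hz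
    rw [eq_div_iff (hq' z (by simpa using (mem_ball_zero_iff.1 hz).le)), mul_comm, h' z hz]
  have hz : ((1 + δ / 2 : ℝ) : ℂ) ∈ Metric.ball (0 : ℂ) (δ + 1) := by
    rw [mem_ball_zero_iff, Complex.norm_real, Real.norm_eq_abs, abs_of_pos (by positivity)]
    linarith
  have hs := (Complex.hasSum_taylorSeries_on_ball hd hz).summable.norm
  refine Summable.of_nonneg_of_le (fun n => norm_nonneg _) (fun n => ?_) hs
  rw [hev.iteratedDeriv_eq, norm_mul, norm_smul, norm_smul]
  refine mul_le_mul_of_nonneg_left ?_ (norm_nonneg _)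
  refine le_mul_of_one_le_left (norm_nonneg _) ?_
  rw [sub_zero, norm_pow, Complex.norm_real, Real.norm_eq_abs, abs_of_pos (by positivity)]
  exact one_le_pow₀ (by linarith)

variable {m : ℕ} {F : ℂ → Matrix (Fin m) (Fin m) ℂ}

/-- `F = P / q` on the disc, with a common polynomial denominator `q`. -/
def IsFraction (F : ℂ → Matrix (Fin m) (Fin m) ℂ) (q : ℂ[X])
    (P : Matrix (Fin m) (Fin m) ℂ[X]) : Prop :=
  q ≠ 0 ∧ ∀ z ∈ Metric.ball (0 : ℂ) 1, ∀ i j, q.eval z * F z i j = (P i j).eval z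

lemma IsHInf.exists_isFraction (hF : IsHInf F) (hR : IsRationalMatrix F) :
    ∃ q P, IsFraction F q P := by
  choose p q hq h using hR
  have hdvd : ∀ i j, ∃ r, ∏ i, ∏ j, q i j = q i j * r := fun i j =>
    (Finset.dvd_prod_of_mem (q i) (Finset.mem_univ j)).trans
      (Finset.dvd_prod_of_mem (fun i => ∏ j, q i j) (Finset.mem_univ i))
  choose r hr using hdvd
  refine ⟨∏ i, ∏ j, q i j, Matrix.of fun i j => r i j * p i j, ?_, fun z hz i j => ?_⟩
  · exact Finset.prod_ne_zero_iff.2 fun i _ => Finset.prod_ne_zero_iff.2 fun j _ => hq i j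
  have h1 : (q i j).eval z * F z i j = (p i j).eval z := by
    refine eqOn_ball_of_eval_smul_eq (hq i j)
      (g := fun z => (q i j).eval z * F z i j) (h := fun z => (p i j).eval z)
      ((q i j).continuous.continuousOn.mul (hF i j).1.continuousOn)
      (p i j).continuous.continuousOn (fun w hw => ?_) z hz
    by_cases h0 : (q i j).eval w = 0
    · simp [h0]
    · simp only [smul_eq_mul]
      rw [h i j w hw h0, mul_div_cancel₀ _ h0]
  rw [hr i j, eval_mul, Matrix.of_apply, eval_mul, ← h1]
  ring

lemma IsFraction.summable_matrixCoeff {q : ℂ[X]} {P : Matrix (Fin m) (Fin m) ℂ[X]}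
    (h : IsFraction F q P) (hF : IsHInf F) : Summable fun n => ‖matrixCoeff F n‖ := by
  have hs : ∀ i j, Summable fun n : ℕ => ‖(n ! : ℂ)⁻¹ * iteratedDeriv n (fun z => F z i j) 0‖ := by
    intro i j
    obtain ⟨hd, B, hB⟩ := hF i j
    exact summable_taylor_of_rational hd hB h.1 fun z hz => h.2 z hz i j
  have hs2 := summable_sum fun i (_ : i ∈ Finset.univ) =>
    summable_sum fun j (_ : j ∈ Finset.univ) =>
      (hs i j).mul_right ‖toEuclideanCLE m (Matrix.single i j 1)‖
  refine Summable.of_nonneg_of_le (fun n => norm_nonneg _) (fun n => ?_) hs2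
  rw [matrixCoeff, Matrix.matrix_eq_sum_single (Matrix.of _), map_sum]
  refine (norm_sum_le _ _).trans (Finset.sum_le_sum fun i _ => ?_)
  rw [map_sum]
  refine (norm_sum_le _ _).trans (Finset.sum_le_sum fun j _ => ?_)
  rw [← norm_smul, ← map_smul, Matrix.smul_single, smul_eq_mul, mul_one, Matrix.of_apply]

/-- The polynomial matrix `P - c q`. -/
def subScalarMatrix (q : ℂ[X]) (P : Matrix (Fin m) (Fin m) ℂ[X]) (c : ℂ) :
    Matrix (Fin m) (Fin m) ℂ[X] :=
  P - (C c * q) • 1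

lemma IsFraction.map_subScalarMatrix {q : ℂ[X]} {P : Matrix (Fin m) (Fin m) ℂ[X]}
    (h : IsFraction F q P) (c : ℂ) {z : ℂ} (hz : z ∈ Metric.ball (0 : ℂ) 1) :
    (subScalarMatrix q P c).map (evalRingHom z) =
      q.eval z • (F z - c • (1 : Matrix (Fin m) (Fin m) ℂ)) := by
  ext i j
  by_cases hij : i = j
  · simp [subScalarMatrix, hij, ← h.2 z hz, mul_sub, mul_comm c]
  · simp [subScalarMatrix, hij, ← h.2 z hz]

lemma IsFraction.eval_det_subScalarMatrix {q : ℂ[X]} {P : Matrix (Fin m) (Fin m) ℂ[X]}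
    (h : IsFraction F q P) (c : ℂ) {z : ℂ} (hz : z ∈ Metric.ball (0 : ℂ) 1) :
    (subScalarMatrix q P c).det.eval z =
      q.eval z ^ m * (F z - c • (1 : Matrix (Fin m) (Fin m) ℂ)).det := by
  rw [← coe_evalRingHom, RingHom.map_det]
  have := h.map_subScalarMatrix c hz
  rw [RingHom.mapMatrix_apply, this, Matrix.det_smul, Fintype.card_fin, coe_evalRingHom]

lemma IsFraction.det_ne_zero {q : ℂ[X]} {P : Matrix (Fin m) (Fin m) ℂ[X]}
    (h : IsFraction F q P) (hF : IsHInf F) (hN : IsNondegenerate F) (c : ℂ) :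
    (subScalarMatrix q P c).det ≠ 0 := by
  intro h0
  obtain ⟨z₀, hz₀, hdet⟩ := hN c
  have hc : ContinuousOn F (Metric.ball 0 1) :=
    continuousOn_pi.2 fun i => continuousOn_pi.2 fun j => (hF i j).1.continuousOn
  refine hdet (eqOn_ball_of_eval_smul_eq (pow_ne_zero m h.1)
    (g := fun z => (F z - c • (1 : Matrix (Fin m) (Fin m) ℂ)).det) (h := fun _ => 0)
    ?_ continuousOn_const (fun z hz => ?_) z₀ hz₀)
  · exact (Continuous.matrix_det continuous_id).comp_continuousOn (hc.sub continuousOn_const)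
  · rw [smul_zero, smul_eq_mul, eval_pow, ← h.eval_det_subScalarMatrix c hz, h0, eval_zero]

/-- Evaluation at a point of the disc, as a linear map on `H²_m`. -/
def HardyTwo.evalLinear {t : ℂ} (ht : t ∈ Metric.ball (0 : ℂ) 1) :
    HardyTwo m →ₗ[ℂ] EuclideanSpace ℂ (Fin m) where
  toFun f := f.eval t
  map_add' f g := f.eval_add g ht
  map_smul' c f := f.eval_smul c ht

/-- If `det (F - c)` vanishes identically, then `c` is an eigenvalue of `T_F`. -/
lemma IsFraction.exists_eigenvector {q : ℂ[X]} {P : Matrix (Fin m) (Fin m) ℂ[X]}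
    (h : IsFraction F q P) (hF : IsHInf F) {c : ℂ}
    (hdet : ∀ z ∈ Metric.ball (0 : ℂ) 1, (F z - c • (1 : Matrix (Fin m) (Fin m) ℂ)).det = 0) :
    ∃ x : HardyTwo m, x ≠ 0 ∧ toeplitz F hF x = c • x := by
  have h0 : (subScalarMatrix q P c).det = 0 := Polynomial.eq_zero_of_eval_ball fun z hz => by
    rw [h.eval_det_subScalarMatrix c hz, hdet z hz, mul_zero]
  obtain ⟨v, hv, hPv⟩ := Matrix.exists_mulVec_eq_zero_iff.2 h0
  let D := (∑ i, (v i).natDegree) + 1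
  have hD : ∀ i, (v i).natDegree < D := fun i => Nat.lt_succ_of_le
    (Finset.single_le_sum (f := fun i => (v i).natDegree) (fun _ _ => Nat.zero_le _)
      (Finset.mem_univ i))
  let x : HardyTwo m := ∑ n ∈ Finset.range D,
    lp.single 2 n (WithLp.toLp 2 fun i => (v i).coeff n)
  have hx : ∀ z ∈ Metric.ball (0 : ℂ) 1, x.eval z = WithLp.toLp 2 fun i => (v i).eval z := by
    intro z hz
    change HardyTwo.evalLinear hz x = _
    rw [map_sum]
    ext i
    simp only [HardyTwo.evalLinear, LinearMap.coe_mk, AddHom.coe_mk, HardyTwo.eval_single]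
    rw [eval_eq_sum_range' (hD i)]
    simp [mul_comm]
  refine ⟨x, fun hx0 => hv ?_, ?_⟩
  · funext i
    refine Polynomial.eq_zero_of_eval_ball fun z hz => ?_
    have h1 := hx z hz
    rw [hx0] at h1
    have h2 : HardyTwo.eval (0 : HardyTwo m) z = 0 := (HardyTwo.evalLinear hz).map_zero
    rw [h2] at h1
    exact (congrFun (congrArg WithLp.ofLp h1) i).symm
  · refine HardyTwo.ext_eval fun z hz => ?_
    refine eqOn_ball_of_eval_smul_eq h.1 (toeplitz F hF x).differentiableOn_eval.continuousOn
      (c • x).differentiableOn_eval.continuousOn (fun z hz => ?_) z hz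
    rw [toeplitz_eval_clm hF x hz, HardyTwo.eval_smul c x hz, hx z hz,
      Matrix.toEuclideanCLM_toLp]
    have h1 : (evalRingHom z) ∘ (subScalarMatrix q P c *ᵥ v) = 0 := by
      rw [hPv]; ext; simp
    have h2 : (subScalarMatrix q P c).map (evalRingHom z) *ᵥ (evalRingHom z ∘ v) = 0 := by
      rw [← h1]
      funext i
      exact (RingHom.map_mulVec (evalRingHom z) (subScalarMatrix q P c) v i).symm
    rw [h.map_subScalarMatrix c hz, Matrix.smul_mulVec, Matrix.sub_mulVec, Matrix.smul_mulVec,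
      Matrix.one_mulVec, smul_sub, sub_eq_zero] at h2
    have h3 : (evalRingHom z ∘ v : Fin m → ℂ) = fun i => (v i).eval z := rfl
    rw [h3] at h2
    rw [← WithLp.toLp_smul, h2]
    rfl

end Rational

/-! ### Rationality of the symbol -/

section Kronecker

open Polynomial

/-- A power series whose coefficients satisfy a linear recurrence is rational. -/
lemma exists_rational_of_recurrence {f : ℂ → ℂ} {a : ℕ → ℂ}
    (hf : ∀ z ∈ Metric.ball (0 : ℂ) 1, HasSum (fun n => z ^ n * a n) (f z)) {s : Finset ℕ}
    {g : ℕ → ℂ} {j₀ : ℕ} (hj₀ : j₀ ∈ s) (hg : g j₀ ≠ 0)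
    (hrec : ∀ n, ∑ j ∈ s, g j * a (n + j + 1) = 0) :
    ∃ p q : ℂ[X], q ≠ 0 ∧ ∀ z ∈ Metric.ball (0 : ℂ) 1, q.eval z * f z = p.eval z := by
  set D := s.sup id
  have hD : ∀ j ∈ s, j ≤ D := fun j hj => Finset.le_sup (f := id) hj
  let c : ℕ → ℂ := fun N => ∑ j ∈ s, g j * if D - j ≤ N then a (N - (D - j)) else 0
  refine ⟨∑ N ∈ Finset.range (D + 1), C (c N) * X ^ N, ∑ j ∈ s, C (g j) * X ^ (D - j), ?_, ?_⟩
  · intro h0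
    have h1 := congrArg (fun r : ℂ[X] => r.coeff (D - j₀)) h0
    simp only [finsetSum_coeff, coeff_C_mul_X_pow, coeff_zero] at h1
    rw [Finset.sum_eq_single j₀] at h1
    · simp at h1
      exact hg h1
    · intro j hj hne
      rw [if_neg]
      have := hD j hj
      have := hD j₀ hj₀
      omega
    · exact fun h => absurd hj₀ h
  · intro z hz
    have hshift : ∀ r, HasSum (fun N => z ^ N * if r ≤ N then a (N - r) else 0)
        (z ^ r * f z) := by
      intro r
      rw [← (add_left_injective r).hasSum_iff]
      · refine ((hf z hz).mul_left (z ^ r)).congr_fun fun n => ?_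
        simp [pow_add]
        ring
      · intro n hn
        rw [if_neg, mul_zero]
        intro hjn
        exact hn ⟨n - r, Nat.sub_add_cancel hjn⟩
    have h1 : HasSum (fun N => z ^ N * c N) (∑ j ∈ s, g j * (z ^ (D - j) * f z)) := by
      refine (hasSum_sum fun j _ => (hshift (D - j)).mul_left (g j)).congr_fun fun N => ?_
      simp only [c, Finset.mul_sum]
      exact Finset.sum_congr rfl fun j _ => by ring
    have h2 : HasSum (fun N => z ^ N * c N) (∑ N ∈ Finset.range (D + 1), z ^ N * c N) := by
      refine hasSum_sum_of_ne_finset_zero fun N hN => ?_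
      rw [Finset.mem_range, not_lt] at hN
      obtain ⟨n, rfl⟩ := Nat.exists_eq_add_of_le hN
      rw [mul_eq_zero]
      right
      rw [← hrec n]
      refine Finset.sum_congr rfl fun j hj => ?_
      have := hD j hj
      rw [if_pos (by omega), show D + 1 + n - (D - j) = n + j + 1 by omega]
    have h3 := h1.unique h2
    simp only [eval_finsetSum, eval_mul, eval_C, eval_pow, eval_X, Finset.sum_mul]
    rw [Finset.sum_congr rfl fun N _ => mul_comm (c N) (z ^ N), ← h3]
    exact Finset.sum_congr rfl fun j _ => by ring

variable {m : ℕ} {F : ℂ → Matrix (Fin m) (Fin m) ℂ}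
  {A : ℕ → EuclideanSpace ℂ (Fin m) →L[ℂ] EuclideanSpace ℂ (Fin m)}

lemma inner_selfCommutator_sum (hF : IsHInf F) (hA : HasCoeffs F A) (hN : CoeffsNormal F hF A)
    (s : Finset ℕ) (g : ℕ → ℂ) (v : EuclideanSpace ℂ (Fin m)) :
    ⟪∑ j ∈ s, g j • selfCommutator (toeplitz F hF) (lp.single 2 j v),
      (∑ j ∈ s, g j • lp.single 2 j v : HardyTwo m)⟫_ℂ =
    ⟪∑ j ∈ s, g j • tailVector hF hA (j + 1) v, ∑ j ∈ s, g j • tailVector hF hA (j + 1) v⟫_ℂ := by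
  simp only [sum_inner, inner_sum, inner_smul_left, inner_smul_right,
    inner_selfCommutator_single hF hA hN]

lemma isRationalMatrix_of_finiteRank (hF : IsHInf F) (hA : HasCoeffs F A)
    [FiniteDimensional ℂ (LinearMap.range
      (selfCommutator (toeplitz F hF) : HardyTwo m →ₗ[ℂ] HardyTwo m))] :
    IsRationalMatrix F := by
  intro i k
  have hN := coeffsNormal_of_finiteRank hF hA
  set R := LinearMap.range (selfCommutator (toeplitz F hF) : HardyTwo m →ₗ[ℂ] HardyTwo m)
  let e : EuclideanSpace ℂ (Fin m) := EuclideanSpace.single i 1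
  let u : ℕ → R := fun j => ⟨selfCommutator (toeplitz F hF) (lp.single 2 j e),
    LinearMap.mem_range_self _ _⟩
  have hu : ¬ LinearIndependent ℂ u := fun h => by
    have := h.finite
    exact not_finite ℕ
  rw [not_linearIndependent_iff] at hu
  obtain ⟨s, g, hsum, j₀, hj₀, hg⟩ := hu
  have h1 : ∑ j ∈ s, g j • selfCommutator (toeplitz F hF) (lp.single 2 j e) = 0 := by
    have := congrArg (fun r : R => (r : HardyTwo m)) hsum
    simpa [u] using this
  have h2 := inner_selfCommutator_sum hF hA hN s g e
  rw [h1, inner_zero_left, eq_comm, inner_self_eq_zero] at h2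
  have h3 : ∀ n, ∑ j ∈ s, g j • ContinuousLinearMap.adjoint (A (n + (j + 1))) e = 0 := by
    intro n
    have := congrArg (fun f : HardyTwo m => f n) h2
    simp only [lp.coeFn_sum, lp.coeFn_smul, lp.coeFn_zero, Pi.zero_apply] at this
    exact (Finset.sum_apply n s _).symm.trans this
  have hentry : ∀ n, ⟪ContinuousLinearMap.adjoint (A n) e, EuclideanSpace.single k (1 : ℂ)⟫_ℂ =
      (toEuclideanCLE m).symm (A n) i k := by
    intro n
    obtain ⟨M, hM⟩ := (toEuclideanCLE m).surjective (A n)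
    rw [ContinuousLinearMap.adjoint_inner_left, ← hM, ContinuousLinearEquiv.symm_apply_apply]
    simp [e, toEuclideanCLE_apply, EuclideanSpace.inner_single_left]
  obtain ⟨p, q, hq, h⟩ := exists_rational_of_recurrence
    (f := fun z => F z i k) (a := fun n => (toEuclideanCLE m).symm (A n) i k)
    (fun z hz => hasCoeffs_iff_entry.1 hA z hz i k) hj₀
    (g := fun j => starRingEnd ℂ (g j)) (by simpa using hg) (fun n => by
      have := congrArg (fun v => ⟪v, EuclideanSpace.single k (1 : ℂ)⟫_ℂ) (h3 n)
      simp only [sum_inner, inner_smul_left, inner_zero_left, hentry] at this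
      exact this)
  exact ⟨p, q, hq, fun z hz hqz => by rw [eq_div_iff hqz, mul_comm, h z hz]⟩

end Kronecker

/-! ### Purity -/

section Purity

open Polynomial

variable {K : Type*} [NormedAddCommGroup K] [InnerProductSpace ℂ K]

lemma aeval_injective_of_no_eigenvector {N : K →L[ℂ] K}
    (hinj : ∀ (c : ℂ) (x : K), N x = c • x → x = 0) (n : ℕ) :
    ∀ p : ℂ[X], p.natDegree = n → p ≠ 0 → ∀ x : K, aeval N p x = 0 → x = 0 := by
  induction n with
  | zero =>
    intro p hn hp x hx
    rw [eq_C_of_natDegree_eq_zero hn] at hp hx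
    rw [aeval_C, Algebra.algebraMap_eq_smul_one] at hx
    exact (smul_eq_zero.1 hx).resolve_left fun h => hp (by rw [h, C_0])
  | succ n ih =>
    intro p hn hp x hx
    obtain ⟨c, hc⟩ := IsAlgClosed.exists_root p (by
      rw [degree_eq_natDegree hp, hn]; exact_mod_cast Nat.succ_ne_zero n)
    obtain ⟨r, rfl⟩ := dvd_iff_isRoot.2 hc
    have hr : r ≠ 0 := right_ne_zero_of_mul hp
    rw [natDegree_mul (X_sub_C_ne_zero c) hr, natDegree_X_sub_C] at hn
    refine ih r (by omega) hr x (hinj c _ ?_)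
    rw [map_mul, mul_apply_eq_comp, map_sub, aeval_X, aeval_C,
      Algebra.algebraMap_eq_smul_one] at hx
    simpa [sub_eq_zero] using hx

variable [CompleteSpace K]

/-- Let `N` be normal without eigenvectors and `U` a unitary commuting with `N`. If `H₀` is a closed
subspace invariant under `U`, with `⋂ Uᵏ H₀ = 0` and `p(N) H₀ ⊆ U H₀` for a non-zero
polynomial `p`, then no non-zero vector has its orbit under `N*` contained in `H₀`. -/
lemma eq_zero_of_adjoint_orbit_mem {N U : K →L[ℂ] K} (hN : IsStarNormal N)
    (hU : U ∈ unitary (K →L[ℂ] K)) (hUN : Commute U N)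
    (hinj : ∀ (c : ℂ) (x : K), N x = c • x → x = 0) {H₀ : Submodule ℂ K}
    (hcl : IsClosed (H₀ : Set K)) (hUH : ∀ x ∈ H₀, U x ∈ H₀)
    {p : ℂ[X]} (hp : p ≠ 0) (hpH : ∀ x ∈ H₀, ∃ y ∈ H₀, aeval N p x = U y)
    (hcap : ∀ x, (∀ k : ℕ, ∃ y ∈ H₀, x = (U ^ k) y) → x = 0) {x : K}
    (hx : ∀ k : ℕ, (star N ^ k) x ∈ H₀) : x = 0 := by
  obtain ⟨hU1, hU2⟩ := Unitary.mem_iff.1 hU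
  have hNN : Commute (star N) N := hN.star_comm_self
  have hNU' : star N * star U = star U * star N := by
    rw [← star_mul, ← star_mul, hUN.eq]
  have hNU : Commute (star N) U := by
    calc star N * U = U * (star U * star N) * U := by
          rw [← mul_assoc U, hU2, one_mul]
      _ = U * star N * (star U * U) := by rw [← hNU']; simp only [mul_assoc]
      _ = U * star N := by rw [hU1, mul_one]
  have hcU : ∀ x, star U (U x) = x := fun x => by
    rw [← mul_apply_eq_comp, hU1, one_apply_eq_self]
  have hUc : ∀ x, U (star U x) = x := fun x => by
    rw [← mul_apply_eq_comp, hU2, one_apply_eq_self]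
  have hpow : ∀ (k : ℕ) (B : K →L[ℂ] K), Commute (star N) B → ∀ x,
      (star N ^ k) (B x) = B ((star N ^ k) x) := fun k B hB x => by
    rw [← mul_apply_eq_comp, (hB.pow_left k).eq, mul_apply_eq_comp]
  let M : Submodule ℂ K := ⨅ k : ℕ, H₀.comap ((star N ^ k : K →L[ℂ] K) : K →ₗ[ℂ] K)
  have hM : ∀ x, x ∈ M ↔ ∀ k : ℕ, (star N ^ k) x ∈ H₀ := fun x => by
    simp only [M, Submodule.mem_iInf, Submodule.mem_comap]
    rfl
  have hMcl : IsClosed (M : Set K) := by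
    have : (M : Set K) = ⋂ k : ℕ, (star N ^ k) ⁻¹' (H₀ : Set K) := by
      ext x
      simp [hM]
    rw [this]
    exact isClosed_iInter fun k => hcl.preimage (star N ^ k).continuous
  have hMU : ∀ x ∈ M, U x ∈ M := fun x hx => (hM _).2 fun k => by
    rw [hpow k U hNU]; exact hUH _ ((hM x).1 hx k)
  have hMN : ∀ x ∈ M, star N x ∈ M := fun x hx => (hM _).2 fun k => by
    rw [← mul_apply_eq_comp, ← pow_succ]; exact (hM x).1 hx (k + 1)
  have hpN : ∀ r : ℂ[X], Commute (star N) (aeval N r) := fun r => by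
    induction r using Polynomial.induction_on' with
    | add a b ha hb => rw [map_add]; exact ha.add_right hb
    | monomial n a =>
      rw [aeval_monomial]
      exact (Algebra.commute_algebraMap_right _ _).mul_right (hNN.pow_right n)
  have hW : ∀ x ∈ M, (∀ y ∈ M, ⟪U y, x⟫_ℂ = 0) → x = 0 := by
    intro x hx hort
    have horbit : ∀ n : ℕ, ∀ y ∈ M, ⟪U y, (N ^ n) x⟫_ℂ = 0 := by
      intro n
      induction n with
      | zero => simpa using hort
      | succ n ih =>
        intro y hy
        rw [pow_succ', mul_apply_eq_comp, ← ContinuousLinearMap.adjoint_inner_left,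
          ← ContinuousLinearMap.star_eq_adjoint, ← mul_apply_eq_comp, hNU.eq,
          mul_apply_eq_comp]
        exact ih _ (hMN y hy)
    have hpoly : ∀ r : ℂ[X], ∀ y ∈ M, ⟪U y, aeval N r x⟫_ℂ = 0 := by
      intro r y hy
      rw [aeval_eq_sum_range, sum_apply, inner_sum]
      refine Finset.sum_eq_zero fun n _ => ?_
      rw [smul_apply, inner_smul_right, horbit n y hy, mul_zero]
    have hz : star U (aeval N p x) ∈ M := (hM _).2 fun k => by
      rw [hpow k (star U) hNU', hpow k _ (hpN p)]
      obtain ⟨y, hy, hyp⟩ := hpH _ ((hM x).1 hx k)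
      rw [hyp, hcU]
      exact hy
    have h0 := hpoly p _ hz
    rw [hUc, inner_self_eq_zero] at h0
    exact aeval_injective_of_no_eigenvector hinj _ p rfl hp x h0
  have hstep : ∀ x ∈ M, ∃ y ∈ M, x = U y := by
    intro x hx
    let R : Submodule ℂ K := M.comap ((star U : K →L[ℂ] K) : K →ₗ[ℂ] K)
    have hR : ∀ x, x ∈ R ↔ star U x ∈ M := fun x => Iff.rfl
    have hRcl : IsClosed (R : Set K) := hMcl.preimage (star U).continuous
    have : CompleteSpace R := hRcl.completeSpace_coe
    have hRM : ∀ x ∈ R, x ∈ M := fun x hx => by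
      rw [← hUc x]; exact hMU _ hx
    have h0 : x - R.starProjection x = 0 := by
      refine hW _ (M.sub_mem hx (hRM _ (R.starProjection_apply_mem x))) fun y hy => ?_
      have hy' : U y ∈ R := by rw [hR, hcU]; exact hy
      exact (R.sub_starProjection_mem_orthogonal x) (U y) hy'
    have hxR : x ∈ R := by
      rw [sub_eq_zero.1 h0]; exact R.starProjection_apply_mem x
    exact ⟨star U x, hxR, (hUc x).symm⟩
  have hall : ∀ k : ℕ, ∀ x ∈ M, ∃ y ∈ M, x = (U ^ k) y := by
    intro k
    induction k with
    | zero => exact fun x hx => ⟨x, hx, by simp⟩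
    | succ k ih =>
      intro x hx
      obtain ⟨y, hy, rfl⟩ := ih x hx
      obtain ⟨z, hz, rfl⟩ := hstep y hy
      exact ⟨z, hz, by rw [pow_succ, mul_apply_eq_comp]⟩
  refine hcap x fun k => ?_
  obtain ⟨y, hy, hxy⟩ := hall k x ((hM x).2 hx)
  exact ⟨y, by simpa using (hM y).1 hy 0, hxy⟩

/-- On an invariant subspace where a subnormal operator is normal, its adjoint is the restriction of
the adjoint of any normal extension. -/
lemma adjoint_normalExtension_apply {H : Type*} [NormedAddCommGroup H] [InnerProductSpace ℂ H]
    {S : H →L[ℂ] H} {J : H →ₗᵢ[ℂ] K} {N : K →L[ℂ] K} (hN : IsStarNormal N)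
    (hJ : ∀ x, N (J x) = J (S x)) {L : Submodule ℂ H} [CompleteSpace L] {R : L →L[ℂ] L}
    (hR : ∀ x : L, (R x : H) = S x) (hRn : IsStarNormal R) (x : L) :
    star N (J x) = J (star R x : L) := by
  have h1 : ‖star N (J x)‖ = ‖(star R x : L)‖ := by
    rw [ContinuousLinearMap.star_eq_adjoint, ContinuousLinearMap.star_eq_adjoint,
      ← ContinuousLinearMap.isStarNormal_iff_norm_eq_adjoint.1 hN,
      ← ContinuousLinearMap.isStarNormal_iff_norm_eq_adjoint.1 hRn, hJ, J.norm_map, ← hR]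
    rfl
  have h2 : ⟪star N (J x), J (star R x : L)⟫_ℂ = (‖(star R x : L)‖ : ℂ) ^ 2 := by
    rw [ContinuousLinearMap.star_eq_adjoint N, ContinuousLinearMap.adjoint_inner_left, hJ,
      J.inner_map_map, ← hR, ← Submodule.coe_inner, ← ContinuousLinearMap.adjoint_inner_left,
      ← ContinuousLinearMap.star_eq_adjoint, inner_self_eq_norm_sq_to_K]
    rfl
  rw [← sub_eq_zero, ← norm_eq_zero, ← sq_eq_zero_iff, @norm_sub_sq ℂ, h1, h2, J.norm_map]
  have h3 : RCLike.re ((‖(star R x : L)‖ : ℂ) ^ 2) = ‖(star R x : L)‖ ^ 2 := by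
    rw [← Complex.ofReal_pow]; rfl
  rw [h3, show ‖((star R x : L) : H)‖ = ‖(star R x : L)‖ from rfl]
  ring

end Purity

/-! ### Multiplication operators on vector valued `L²` of the circle -/

section Multiplication

attribute [local instance] fact_two_pi_pos

variable {E : Type*} [NormedAddCommGroup E] [InnerProductSpace ℂ E]

/-- The circle `ℝ / 2π`. -/
abbrev CircleGroup : Type := AddCircle (2 * Real.pi)

/-- `L²` of the circle with values in `E`. -/
abbrev CircleL2 (E : Type*) [NormedAddCommGroup E] : Type _ :=
  Lp E 2 (AddCircle.haarAddCircle (T := 2 * Real.pi))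

lemma memLp_mul (Φ : C(CircleGroup, E →L[ℂ] E)) (f : CircleL2 E) :
    MemLp (fun t => Φ t (f t)) 2 (AddCircle.haarAddCircle (T := 2 * Real.pi)) := by
  refine (Lp.memLp f).of_le_mul (c := ‖Φ‖) ?_ (Eventually.of_forall fun t => ?_)
  · exact (ContinuousLinearMap.id ℂ (E →L[ℂ] E)).aestronglyMeasurable_comp₂
      (Φ.continuous.aestronglyMeasurable) (Lp.aestronglyMeasurable f)
  · exact ((Φ t).le_opNorm _).trans
      (mul_le_mul_of_nonneg_right (Φ.norm_coe_le_norm t) (norm_nonneg _))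

/-- Multiplication by a continuous operator valued function on `L²` of the circle. -/
def mulOp (Φ : C(CircleGroup, E →L[ℂ] E)) : CircleL2 E →L[ℂ] CircleL2 E :=
  LinearMap.mkContinuous
    { toFun := fun f => (memLp_mul Φ f).toLp
      map_add' := fun f g => by
        ext1
        filter_upwards [(memLp_mul Φ (f + g)).coeFn_toLp, (memLp_mul Φ f).coeFn_toLp,
          (memLp_mul Φ g).coeFn_toLp, Lp.coeFn_add f g,
          Lp.coeFn_add (memLp_mul Φ f).toLp (memLp_mul Φ g).toLp] with t h1 h2 h3 h4 h5
        rw [h1, h5, Pi.add_apply, h2, h3, h4, Pi.add_apply, map_add]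
      map_smul' := fun c f => by
        ext1
        filter_upwards [(memLp_mul Φ (c • f)).coeFn_toLp, (memLp_mul Φ f).coeFn_toLp,
          Lp.coeFn_smul c f, Lp.coeFn_smul c (memLp_mul Φ f).toLp] with t h1 h2 h3 h4
        rw [h1, RingHom.id_apply, h4, Pi.smul_apply, h2, h3, Pi.smul_apply, map_smul] }
    ‖Φ‖ (fun f => by
      refine Lp.norm_le_mul_norm_of_ae_le_mul ?_
      filter_upwards [(memLp_mul Φ f).coeFn_toLp] with t h1
      rw [LinearMap.coe_mk, AddHom.coe_mk, h1]
      exact ((Φ t).le_opNorm _).trans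
        (mul_le_mul_of_nonneg_right (Φ.norm_coe_le_norm t) (norm_nonneg _)))

lemma coeFn_mulOp (Φ : C(CircleGroup, E →L[ℂ] E)) (f : CircleL2 E) :
    mulOp Φ f =ᵐ[AddCircle.haarAddCircle] fun t => Φ t (f t) :=
  (memLp_mul Φ f).coeFn_toLp

lemma mulOp_mul (Φ Ψ : C(CircleGroup, E →L[ℂ] E)) : mulOp (Φ * Ψ) = mulOp Φ * mulOp Ψ := by
  ext1 f
  ext1
  filter_upwards [coeFn_mulOp (Φ * Ψ) f, coeFn_mulOp Φ (mulOp Ψ f), coeFn_mulOp Ψ f]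
    with t h1 h2 h3
  rw [h1, mul_apply_eq_comp, h2, h3]
  rfl

lemma mulOp_one : mulOp (1 : C(CircleGroup, E →L[ℂ] E)) = 1 := by
  ext1 f
  ext1
  filter_upwards [coeFn_mulOp 1 f] with t h1
  rw [h1]
  rfl

lemma star_mulOp [CompleteSpace E] (Φ : C(CircleGroup, E →L[ℂ] E)) :
    star (mulOp Φ) = mulOp (star Φ) := by
  rw [ContinuousLinearMap.star_eq_adjoint, eq_comm, ContinuousLinearMap.eq_adjoint_iff]
  intro f g
  rw [L2.inner_def, L2.inner_def]
  refine integral_congr_ae ?_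
  filter_upwards [coeFn_mulOp (star Φ) f, coeFn_mulOp Φ g] with t h1 h2
  rw [h1, h2, ContinuousMap.star_apply, ContinuousLinearMap.star_eq_adjoint,
    ContinuousLinearMap.adjoint_inner_left]

/-- Continuous functions as elements of `L²` of the circle. -/
abbrev contToL2 (E : Type*) [NormedAddCommGroup E] [InnerProductSpace ℂ E] :
    C(CircleGroup, E) →L[ℂ] CircleL2 E :=
  ContinuousMap.toLp 2 (AddCircle.haarAddCircle (T := 2 * Real.pi)) ℂ

lemma mulOp_contToL2 (Φ : C(CircleGroup, E →L[ℂ] E)) (g g' : C(CircleGroup, E))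
    (h : ∀ t, g' t = Φ t (g t)) : mulOp Φ (contToL2 E g) = contToL2 E g' := by
  ext1
  filter_upwards [coeFn_mulOp Φ (contToL2 E g),
    ContinuousMap.coeFn_toLp (p := 2) (𝕜 := ℂ) AddCircle.haarAddCircle g,
    ContinuousMap.coeFn_toLp (p := 2) (𝕜 := ℂ) AddCircle.haarAddCircle g'] with t h1 h2 h3
  rw [h1, h2, h3, h]

lemma inner_contToL2 (g g' : C(CircleGroup, E)) :
    ⟪contToL2 E g, contToL2 E g'⟫_ℂ =
      ∫ t, ⟪g t, g' t⟫_ℂ ∂(AddCircle.haarAddCircle (T := 2 * Real.pi)) := by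
  rw [L2.inner_def]
  refine integral_congr_ae ?_
  filter_upwards [ContinuousMap.coeFn_toLp (p := 2) (𝕜 := ℂ) AddCircle.haarAddCircle g,
    ContinuousMap.coeFn_toLp (p := 2) (𝕜 := ℂ) AddCircle.haarAddCircle g'] with t h2 h3
  rw [h2, h3]

/-- The trigonometric monomial `tⁿ v`. -/
def trigMonomial (n : ℤ) (v : E) : C(CircleGroup, E) :=
  ⟨fun t => (fourier n t : ℂ) • v, (fourier n).continuous.smul continuous_const⟩

lemma trigMonomial_apply (n : ℤ) (v : E) (t : CircleGroup) :
    trigMonomial n v t = (fourier n t : ℂ) • v := rfl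

lemma inner_fourier (n k : ℤ) :
    ∫ t, (fourier k t : ℂ) * (starRingEnd ℂ) (fourier n t : ℂ)
      ∂(AddCircle.haarAddCircle (T := 2 * Real.pi)) = if n = k then 1 else 0 := by
  have h := orthonormal_iff_ite.1 (orthonormal_fourier (T := 2 * Real.pi)) n k
  rw [← h, fourierLp, fourierLp, ContinuousMap.inner_toLp]

lemma inner_contToL2_trigMonomial (n k : ℤ) (v w : E) :
    ⟪contToL2 E (trigMonomial n v), contToL2 E (trigMonomial k w)⟫_ℂ =
      if n = k then ⟪v, w⟫_ℂ else 0 := by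
  rw [inner_contToL2]
  simp only [trigMonomial_apply, inner_smul_left, inner_smul_right, ← mul_assoc]
  rw [integral_mul_const, inner_fourier]
  simp

/-- The isometric embedding `v ↦ tⁿ v` into `L²` of the circle. -/
def trigIsometry (n : ℤ) : E →ₗᵢ[ℂ] CircleL2 E :=
  LinearMap.isometryOfInner
    { toFun := fun v => contToL2 E (trigMonomial n v)
      map_add' := fun v w => by
        rw [← map_add]; congr 1; ext t; simp [trigMonomial_apply]
      map_smul' := fun c v => by
        rw [RingHom.id_apply, ← map_smul]; congr 1; ext t
        simp [trigMonomial_apply, smul_comm c] }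
    fun v w => by simpa using inner_contToL2_trigMonomial n n v w

lemma trigIsometry_apply (n : ℤ) (v : E) :
    trigIsometry n v = contToL2 E (trigMonomial n v) := rfl

lemma inner_trigIsometry (n k : ℤ) (v w : E) :
    ⟪trigIsometry n v, trigIsometry k w⟫_ℂ = if n = k then ⟪v, w⟫_ℂ else 0 :=
  inner_contToL2_trigMonomial n k v w

/-- Absolutely convergent trigonometric series converge in `L²`. -/
lemma hasSum_trigIsometry [CompleteSpace E] {c : ℕ → E} (hc : Summable fun n => ‖c n‖) (k : ℕ → ℤ)
    {g : C(CircleGroup, E)} (hg : ∀ t, HasSum (fun n => (fourier (k n) t : ℂ) • c n) (g t)) :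
    HasSum (fun n => trigIsometry (k n) (c n)) (contToL2 E g) := by
  have hs : Summable fun n => trigMonomial (k n) (c n) := by
    refine Summable.of_norm_bounded hc fun n => ?_
    rw [ContinuousMap.norm_le _ (norm_nonneg _)]
    intro t
    rw [trigMonomial_apply, norm_smul, fourier_apply, Circle.norm_coe, one_mul]
  obtain ⟨G, hG⟩ := hs
  have hGg : G = g := by
    ext1 t
    exact ((ContinuousMap.evalCLM ℂ t).hasSum hG).unique (hg t)
  rw [← hGg]
  exact (contToL2 E).hasSum hG

/-- The bilateral shift. -/
def bilateralShift (E : Type*) [NormedAddCommGroup E] [InnerProductSpace ℂ E] :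
    CircleL2 E →L[ℂ] CircleL2 E :=
  mulOp ⟨fun t => (fourier 1 t : ℂ) • (1 : E →L[ℂ] E),
    (fourier 1).continuous.smul continuous_const⟩

lemma bilateralShift_trigIsometry (n : ℤ) (v : E) :
    bilateralShift E (trigIsometry n v) = trigIsometry (n + 1) v := by
  refine mulOp_contToL2 _ _ _ fun t => ?_
  simp only [trigMonomial_apply, ContinuousMap.coe_mk, smul_apply,
    one_apply_eq_self, smul_smul]
  rw [← fourier_add, add_comm]

lemma bilateralShift_mem_unitary [CompleteSpace E] :
    bilateralShift E ∈ unitary (CircleL2 E →L[ℂ] CircleL2 E) := by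
  rw [Unitary.mem_iff, bilateralShift, star_mulOp, ← mulOp_mul, ← mulOp_mul, ← mulOp_one]
  constructor <;> congr 1 <;> ext t v
  · have := Circle.norm_coe (AddCircle.toCircle t)
    simp [smul_smul, Complex.mul_conj', this]
  · have := Circle.norm_coe (AddCircle.toCircle t)
    simp [smul_smul, Complex.conj_mul', this]

lemma commute_bilateralShift_mulOp (Φ : C(CircleGroup, E →L[ℂ] E)) :
    Commute (bilateralShift E) (mulOp Φ) := by
  rw [commute_iff_eq, bilateralShift, ← mulOp_mul, ← mulOp_mul]
  congr 1
  ext t v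
  simp

end Multiplication

/-! ### The Hardy space inside `L²` of the circle -/

section Embedding

attribute [local instance] fact_two_pi_pos

variable {m : ℕ}

lemma orthogonalFamily_trigIsometry_nat : OrthogonalFamily ℂ
    (fun _ : ℕ => EuclideanSpace ℂ (Fin m))
    (fun n : ℕ => trigIsometry (E := EuclideanSpace ℂ (Fin m)) (n : ℤ)) := fun n k hnk v w => by
  rw [inner_trigIsometry, if_neg (by exact_mod_cast hnk)]

/-- The isometric embedding of `H²_m` into `L²` of the circle. -/
def hardyEmbedding (m : ℕ) : HardyTwo m →ₗᵢ[ℂ] CircleL2 (EuclideanSpace ℂ (Fin m)) :=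
  (orthogonalFamily_trigIsometry_nat (m := m)).linearIsometry

lemma hardyEmbedding_single (n : ℕ) (v : EuclideanSpace ℂ (Fin m)) :
    hardyEmbedding m (lp.single 2 n v) = trigIsometry (n : ℤ) v :=
  (orthogonalFamily_trigIsometry_nat (m := m)).linearIsometry_apply_single v

lemma hasSum_hardyEmbedding (f : HardyTwo m) :
    HasSum (fun n : ℕ => trigIsometry (n : ℤ) (f n)) (hardyEmbedding m f) :=
  (orthogonalFamily_trigIsometry_nat (m := m)).hasSum_linearIsometry f

lemma trigIsometry_mem_range {k : ℤ} (hk : 0 ≤ k) (v : EuclideanSpace ℂ (Fin m)) :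
    trigIsometry k v ∈ LinearMap.range (hardyEmbedding m).toLinearMap := by
  lift k to ℕ using hk
  exact ⟨_, hardyEmbedding_single k v⟩

lemma isClosed_range_hardyEmbedding :
    IsClosed (LinearMap.range (hardyEmbedding m).toLinearMap :
      Set (CircleL2 (EuclideanSpace ℂ (Fin m)))) := by
  change IsClosed (Set.range (hardyEmbedding m))
  exact (hardyEmbedding m).isometry.isClosedEmbedding.isClosed_range

lemma HasSum.mem_submodule {K : Type*} [NormedAddCommGroup K] [NormedSpace ℂ K]
    {R : Submodule ℂ K} (hR : IsClosed (R : Set K)) {x : ℕ → K} {y : K} (h : HasSum x y)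
    (hx : ∀ n, x n ∈ R) : y ∈ R :=
  hR.mem_of_tendsto h (Eventually.of_forall fun _ => R.sum_mem fun n _ => hx n)

lemma inner_trigIsometry_hardyEmbedding (n : ℕ) (v : EuclideanSpace ℂ (Fin m)) (f : HardyTwo m) :
    ⟪trigIsometry (n : ℤ) v, hardyEmbedding m f⟫_ℂ = ⟪v, f n⟫_ℂ := by
  rw [← hardyEmbedding_single, LinearIsometry.inner_map_map]
  exact lp.inner_single_left (𝕜 := ℂ) (G := fun _ : ℕ => EuclideanSpace ℂ (Fin m)) n v f

lemma inner_trigIsometry_hardyEmbedding_of_neg {k : ℤ} (hk : k < 0)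
    (v : EuclideanSpace ℂ (Fin m)) (f : HardyTwo m) :
    ⟪trigIsometry k v, hardyEmbedding m f⟫_ℂ = 0 := by
  have h := (innerSL ℂ (trigIsometry k v)).hasSum (hasSum_hardyEmbedding f)
  refine h.unique ?_
  convert! hasSum_zero using 2 with n
  simp only [innerSL_apply_apply]
  rw [inner_trigIsometry, if_neg (by omega)]

end Embedding

/-! ### Boundary values of symbols with summable coefficients -/

section Boundary

attribute [local instance] fact_two_pi_pos

variable {m : ℕ} {F : ℂ → Matrix (Fin m) (Fin m) ℂ}
  {A : ℕ → EuclideanSpace ℂ (Fin m) →L[ℂ] EuclideanSpace ℂ (Fin m)}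

lemma continuousOn_powerSeries (hs : Summable fun n => ‖A n‖) :
    ContinuousOn (fun z : ℂ => ∑' n, z ^ n • A n) (Metric.closedBall 0 1) := by
  refine continuousOn_tsum (u := fun n => ‖A n‖) (fun n => by fun_prop) hs fun n z hz => ?_
  rw [norm_smul, norm_pow]
  exact mul_le_of_le_one_left (norm_nonneg _)
    (pow_le_one₀ (norm_nonneg _) (by simpa using hz))

lemma fourier_one_pow (t : CircleGroup) (n : ℕ) : (fourier 1 t : ℂ) ^ n = fourier n t := by
  simpa [circlePt] using circlePt_pow 1 t n

lemma norm_fourier_apply (n : ℤ) (t : CircleGroup) : ‖(fourier n t : ℂ)‖ = 1 := by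
  rw [fourier_apply, Circle.norm_coe]

/-- The boundary function `∑ Aₙ tⁿ` on the circle. -/
def boundary (A : ℕ → EuclideanSpace ℂ (Fin m) →L[ℂ] EuclideanSpace ℂ (Fin m))
    (hs : Summable fun n => ‖A n‖) :
    C(CircleGroup, EuclideanSpace ℂ (Fin m) →L[ℂ] EuclideanSpace ℂ (Fin m)) :=
  ⟨fun t => ∑' n, (fourier 1 t : ℂ) ^ n • A n,
    (continuousOn_powerSeries hs).comp_continuous (fourier 1).continuous fun t =>
      mem_closedBall_zero_iff.2 (norm_fourier_apply 1 t).le⟩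

lemma boundary_apply (hs : Summable fun n => ‖A n‖) (t : CircleGroup) :
    boundary A hs t = ∑' n, (fourier 1 t : ℂ) ^ n • A n := rfl

lemma hasSum_boundary (hs : Summable fun n => ‖A n‖) (t : CircleGroup) :
    HasSum (fun n : ℕ => (fourier n t : ℂ) • A n) (boundary A hs t) := by
  have : Summable fun n : ℕ => (fourier n t : ℂ) • A n :=
    Summable.of_norm (by simpa only [norm_smul, norm_fourier_apply, one_mul] using hs)
  simpa only [boundary_apply, fourier_one_pow] using this.hasSum

lemma hasSum_mulOp_boundary (hs : Summable fun n => ‖A n‖) (j : ℤ)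
    (v : EuclideanSpace ℂ (Fin m)) :
    HasSum (fun n : ℕ => trigIsometry (j + n) (A n v))
      (mulOp (boundary A hs) (trigIsometry j v)) := by
  rw [trigIsometry_apply, mulOp_contToL2 (boundary A hs) _
    ⟨fun t => boundary A hs t (trigMonomial j v t),
      (boundary A hs).continuous.clm_apply (trigMonomial j v).continuous⟩ fun t => rfl]
  refine hasSum_trigIsometry ?_ _ fun t => ?_
  · exact Summable.of_nonneg_of_le (fun n => norm_nonneg _) (fun n => (A n).le_opNorm v)
      (hs.mul_right _)
  · have h := (ContinuousLinearMap.apply ℂ _ (trigMonomial j v t)).hasSum (hasSum_boundary hs t)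
    refine h.congr_fun fun n => ?_
    simp only [trigMonomial_apply, map_smul, ContinuousLinearMap.apply_apply, smul_apply,
      smul_smul]
    rw [← fourier_add, add_comm]

lemma hasSum_star_mulOp_boundary (hs : Summable fun n => ‖A n‖) (j : ℤ)
    (v : EuclideanSpace ℂ (Fin m)) :
    HasSum (fun n : ℕ => trigIsometry (j - n) (ContinuousLinearMap.adjoint (A n) v))
      (star (mulOp (boundary A hs)) (trigIsometry j v)) := by
  rw [star_mulOp, trigIsometry_apply, mulOp_contToL2 (star (boundary A hs)) _
    ⟨fun t => star (boundary A hs) t (trigMonomial j v t),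
      (star (boundary A hs)).continuous.clm_apply (trigMonomial j v).continuous⟩ fun t => rfl]
  refine hasSum_trigIsometry ?_ _ fun t => ?_
  · refine Summable.of_nonneg_of_le (fun n => norm_nonneg _)
      (fun n => (ContinuousLinearMap.le_opNorm _ v)) (Summable.mul_right _ ?_)
    simpa using hs
  · have h := (ContinuousLinearMap.apply ℂ _ (trigMonomial j v t)).hasSum
      (hasSum_boundary hs t).star
    refine h.congr_fun fun n => ?_
    simp only [trigMonomial_apply, map_smul, ContinuousLinearMap.apply_apply, smul_apply,
      smul_smul, star_smul, ContinuousLinearMap.star_eq_adjoint]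
    rw [sub_eq_add_neg, fourier_add, fourier_neg, mul_comm]
    rfl

lemma HasCoeffs.tsum_eq (hA : HasCoeffs F A) {z : ℂ} (hz : z ∈ Metric.ball (0 : ℂ) 1) :
    ∑' n, z ^ n • A n = toEuclideanCLE m (F z) := (hA z hz).tsum_eq

/-- The embedded Toeplitz operator is a restriction of multiplication by the boundary function. -/
lemma mulOp_boundary_hardyEmbedding (hF : IsHInf F) (hA : HasCoeffs F A)
    (hs : Summable fun n => ‖A n‖) (f : HardyTwo m) :
    mulOp (boundary A hs) (hardyEmbedding m f) = hardyEmbedding m (toeplitz F hF f) := by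
  have h : (mulOp (boundary A hs)) ∘L (hardyEmbedding m).toContinuousLinearMap =
      (hardyEmbedding m).toContinuousLinearMap ∘L toeplitz F hF := by
    refine HardyTwo.clm_ext fun j v => ?_
    simp only [ContinuousLinearMap.comp_apply, LinearIsometry.coe_toContinuousLinearMap]
    rw [hardyEmbedding_single]
    refine (hasSum_mulOp_boundary hs j v).unique ?_
    have h1 := hasSum_hardyEmbedding (toeplitz F hF (lp.single 2 j v))
    rw [← (add_left_injective j).hasSum_iff] at h1
    · refine h1.congr_fun fun n => ?_
      simp [toeplitz_single hF hA, add_comm]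
    · intro n hn
      rw [toeplitz_single hF hA, if_neg, map_zero]
      intro hjn
      exact hn ⟨n - j, Nat.sub_add_cancel hjn⟩
  exact congrArg (fun R => R f) h

/-- The radial limits of `F` are the values of the boundary function. -/
lemma tendsto_radial (hA : HasCoeffs F A) (hs : Summable fun n => ‖A n‖) (θ : ℝ) :
    Tendsto (fun r : ℝ => F (r * Complex.exp (θ * Complex.I))) (𝓝[<] 1)
      (𝓝 ((toEuclideanCLE m).symm (boundary A hs (θ : CircleGroup)))) := by
  have hexp : (fourier 1 (θ : CircleGroup) : ℂ) = Complex.exp (θ * Complex.I) := by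
    rw [fourier_coe_apply]
    congr 1
    have : (Real.pi : ℂ) ≠ 0 := by exact_mod_cast Real.pi_ne_zero
    push_cast
    field_simp
  have hnorm : ‖Complex.exp (θ * Complex.I)‖ = 1 := Complex.norm_exp_ofReal_mul_I θ
  have h1 : Tendsto (fun r : ℝ => (r : ℂ) * Complex.exp (θ * Complex.I)) (𝓝[<] 1)
      (𝓝[Metric.closedBall 0 1] (Complex.exp (θ * Complex.I))) := by
    refine tendsto_nhdsWithin_iff.2 ⟨?_, ?_⟩
    · have : Continuous fun r : ℝ => (r : ℂ) * Complex.exp (θ * Complex.I) := by fun_prop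
      simpa using (this.tendsto 1).mono_left (nhdsWithin_le_nhds (s := Set.Iio (1 : ℝ)))
    · filter_upwards [Ioo_mem_nhdsLT (show (0 : ℝ) < 1 by norm_num)] with r hr
      simp [hnorm, abs_of_pos hr.1, hr.2.le]
  have h2 := (continuousOn_powerSeries hs (Complex.exp (θ * Complex.I)) (by simp [hnorm])).tendsto
  have h3 := ((toEuclideanCLE m).symm.continuous.tendsto _).comp (h2.comp h1)
  rw [boundary_apply, hexp]
  refine h3.congr' ?_
  filter_upwards [Ioo_mem_nhdsLT (show (0 : ℝ) < 1 by norm_num)] with r hr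
  have hz : (r : ℂ) * Complex.exp (θ * Complex.I) ∈ Metric.ball (0 : ℂ) 1 := by
    simp [hnorm, abs_of_pos hr.1, hr.2]
  simp only [Function.comp_apply, hA.tsum_eq hz, ContinuousLinearEquiv.symm_apply_apply]

lemma isStarNormal_symm_iff
    (B : EuclideanSpace ℂ (Fin m) →L[ℂ] EuclideanSpace ℂ (Fin m)) :
    IsStarNormal ((toEuclideanCLE m).symm B) ↔ IsStarNormal B := by
  obtain ⟨M, rfl⟩ := (toEuclideanCLE m).surjective B
  rw [ContinuousLinearEquiv.symm_apply_apply, toEuclideanCLE_apply, isStarNormal_iff,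
    isStarNormal_iff, commute_iff_eq, commute_iff_eq, ← map_star, ← map_mul, ← map_mul]
  exact (EquivLike.injective (Matrix.toEuclideanCLM (n := Fin m) (𝕜 := ℂ))).eq_iff.symm

/-- `F` is normal on the circle if and only if all values of its boundary function are. -/
lemma isNormalMatrix_iff (hA : HasCoeffs F A) (hs : Summable fun n => ‖A n‖) :
    IsNormalMatrix F ↔ ∀ t, IsStarNormal (boundary A hs t) := by
  have h1 : IsNormalMatrix F ↔ ∀ᵐ θ : ℝ, IsStarNormal (boundary A hs (θ : CircleGroup)) := by
    refine eventually_congr (Eventually.of_forall fun θ => ?_)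
    constructor
    · rintro ⟨M, hM, hMn⟩
      rw [← isStarNormal_symm_iff, ← tendsto_nhds_unique hM (tendsto_radial hA hs θ)]
      exact hMn
    · exact fun h => ⟨_, tendsto_radial hA hs θ, (isStarNormal_symm_iff _).2 h⟩
  rw [h1]
  constructor
  · intro h
    have hc : Continuous fun θ : ℝ => boundary A hs (θ : CircleGroup) :=
      (boundary A hs).continuous.comp (AddCircle.continuous_mk' _)
    have hc' : Continuous fun θ : ℝ => star (boundary A hs (θ : CircleGroup)) :=
      (star (boundary A hs)).continuous.comp (AddCircle.continuous_mk' _)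
    have h2 := (Continuous.ae_eq_iff_eq (volume : Measure ℝ) (hc'.mul hc)
      (hc.mul hc')).1 (h.mono fun θ hθ => hθ.star_comm_self.eq)
    intro t
    obtain ⟨θ, rfl⟩ := QuotientAddGroup.mk_surjective t
    exact ⟨congrFun h2 θ⟩
  · exact fun h => Eventually.of_forall fun θ => h _

end Boundary

/-! ### The normal extension -/

section NormalExtension

open Polynomial

attribute [local instance] fact_two_pi_pos

variable {m : ℕ} {F : ℂ → Matrix (Fin m) (Fin m) ℂ}
  {A : ℕ → EuclideanSpace ℂ (Fin m) →L[ℂ] EuclideanSpace ℂ (Fin m)}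

lemma IsFraction.boundary_eq {q : ℂ[X]} {P : Matrix (Fin m) (Fin m) ℂ[X]} (h : IsFraction F q P)
    (hA : HasCoeffs F A) (hs : Summable fun n => ‖A n‖) (t : CircleGroup) :
    q.eval (fourier 1 t : ℂ) • boundary A hs t =
      toEuclideanCLE m (P.map (evalRingHom (fourier 1 t : ℂ))) := by
  have hEq : Set.EqOn (fun z : ℂ => q.eval z • ∑' n, z ^ n • A n)
      (fun z => toEuclideanCLE m (P.map (evalRingHom z))) (Metric.ball 0 1) := by
    intro z hz
    simp only
    rw [hA.tsum_eq hz, ← map_smul]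
    congr 1
    ext i j
    simpa using h.2 z hz i j
  have hc : Continuous fun z : ℂ => toEuclideanCLE m (P.map (evalRingHom z)) :=
    (toEuclideanCLE m).continuous.comp (continuous_matrix fun i j => (P i j).continuous)
  refine hEq.of_subset_closure (t := Metric.closedBall 0 1)
    (q.continuous.continuousOn.smul (continuousOn_powerSeries hs)) hc.continuousOn
    Metric.ball_subset_closedBall (closure_ball (0 : ℂ) one_ne_zero).ge
    (mem_closedBall_zero_iff.2 (norm_fourier_apply 1 t).le)

lemma ae_eval_fourier_ne_zero {d : ℂ[X]} (hd : d ≠ 0) :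
    ∀ᵐ t ∂(AddCircle.haarAddCircle (T := 2 * Real.pi)), d.eval (fourier 1 t : ℂ) ≠ 0 := by
  have : Nontrivial CircleGroup := by
    refine ⟨(0 : CircleGroup), ((Real.pi : ℝ) : CircleGroup), fun h => ?_⟩
    have h1 := congrArg (fun t : CircleGroup => (fourier 1 t : ℂ)) h
    simp only [fourier_eval_zero, fourier_coe_apply] at h1
    have h2 : 2 * (Real.pi : ℂ) * Complex.I * ((1 : ℤ) : ℂ) * (Real.pi : ℂ) /
        ((2 * Real.pi : ℝ) : ℂ) = Real.pi * Complex.I := by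
      have : (Real.pi : ℂ) ≠ 0 := by exact_mod_cast Real.pi_ne_zero
      push_cast
      field_simp
    rw [h2, Complex.exp_pi_mul_I] at h1
    norm_num at h1
  have hinj : Function.Injective fun t : CircleGroup => (fourier 1 t : ℂ) := by
    intro s t hst
    simp only [fourier_one] at hst
    exact AddCircle.injective_toCircle Real.two_pi_pos.ne' (Circle.coe_injective hst)
  have hfin : {t : CircleGroup | d.eval (fourier 1 t : ℂ) = 0}.Finite := by
    refine ((d.roots.toFinset.finite_toSet).preimage hinj.injOn).subset fun t ht => ?_
    simpa [hd] using ht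
  have h0 := hfin.measure_zero (AddCircle.haarAddCircle (T := 2 * Real.pi))
  rw [ae_iff]
  simpa using h0

lemma mulOp_boundary_no_eigenvector {q : ℂ[X]} {P : Matrix (Fin m) (Fin m) ℂ[X]}
    (h : IsFraction F q P) (hF : IsHInf F) (hA : HasCoeffs F A) (hs : Summable fun n => ‖A n‖)
    (hN : IsNondegenerate F) (c : ℂ) (x : CircleL2 (EuclideanSpace ℂ (Fin m)))
    (hx : mulOp (boundary A hs) x = c • x) : x = 0 := by
  have hd := h.det_ne_zero hF hN c
  ext1
  filter_upwards [ae_eval_fourier_ne_zero hd, coeFn_mulOp (boundary A hs) x, Lp.coeFn_smul c x,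
    Lp.coeFn_zero (EuclideanSpace ℂ (Fin m)) 2 (AddCircle.haarAddCircle (T := 2 * Real.pi))]
    with t h1 h2 h3 h4
  rw [h4]
  rw [hx, h3, Pi.smul_apply] at h2
  set z : ℂ := (fourier 1 t : ℂ)
  have h5 : (subScalarMatrix q P c).map (evalRingHom z) =
      P.map (evalRingHom z) - (c * q.eval z) • (1 : Matrix (Fin m) (Fin m) ℂ) := by
    ext i j
    by_cases hij : i = j
    · simp [subScalarMatrix, hij]
    · simp [subScalarMatrix, hij]
  have h6 : toEuclideanCLE m ((subScalarMatrix q P c).map (evalRingHom z)) (x t) = 0 := by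
    rw [h5, map_sub, ← h.boundary_eq hA hs t, map_smul, toEuclideanCLE_apply, map_one]
    simp only [sub_apply, smul_apply, one_apply_eq_self]
    rw [← h2, smul_smul, mul_comm c, sub_self]
  have h7 : ((subScalarMatrix q P c).map (evalRingHom z)).det ≠ 0 := by
    rw [← RingHom.mapMatrix_apply, ← RingHom.map_det]
    exact h1
  have h8 := Matrix.eq_zero_of_mulVec_eq_zero h7 (v := (x t).ofLp)
    (congrArg WithLp.ofLp h6)
  ext i
  exact congrFun h8 i

lemma isStarNormal_mulOp_boundary (hs : Summable fun n => ‖A n‖)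
    (hb : ∀ t, IsStarNormal (boundary A hs t)) : IsStarNormal (mulOp (boundary A hs)) := by
  refine ⟨?_⟩
  rw [commute_iff_eq, star_mulOp, ← mulOp_mul, ← mulOp_mul]
  congr 1
  ext1 t
  exact (hb t).star_comm_self.eq

lemma bilateralShift_pow_trigIsometry (k : ℕ) (n : ℤ) (v : EuclideanSpace ℂ (Fin m)) :
    (bilateralShift (EuclideanSpace ℂ (Fin m)) ^ k) (trigIsometry n v) = trigIsometry (n + k) v := by
  induction k with
  | zero => simp
  | succ k ih =>
    rw [pow_succ', mul_apply_eq_comp, ih, bilateralShift_trigIsometry]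
    push_cast
    rw [add_assoc]

lemma inner_map_unitary {K : Type*} [NormedAddCommGroup K] [InnerProductSpace ℂ K]
    [CompleteSpace K] {U : K →L[ℂ] K} (hU : U ∈ unitary (K →L[ℂ] K)) (x y : K) :
    ⟪U x, U y⟫_ℂ = ⟪x, y⟫_ℂ := by
  rw [← ContinuousLinearMap.adjoint_inner_right, ← ContinuousLinearMap.star_eq_adjoint,
    ← mul_apply_eq_comp, (Unitary.mem_iff.1 hU).1,
    one_apply_eq_self]

lemma star_bilateralShift_trigIsometry (n : ℤ) (v : EuclideanSpace ℂ (Fin m)) :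
    star (bilateralShift (EuclideanSpace ℂ (Fin m))) (trigIsometry n v) =
      trigIsometry (n - 1) v := by
  have h : trigIsometry n v =
      bilateralShift (EuclideanSpace ℂ (Fin m)) (trigIsometry (n - 1) v) := by
    rw [bilateralShift_trigIsometry, sub_add_cancel]
  rw [h, ← mul_apply_eq_comp,
    (Unitary.mem_iff.1 (bilateralShift_mem_unitary (E := EuclideanSpace ℂ (Fin m)))).1,
    one_apply_eq_self]

lemma bilateralShift_hardyEmbedding_mem (f : HardyTwo m) :
    bilateralShift (EuclideanSpace ℂ (Fin m)) (hardyEmbedding m f) ∈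
      LinearMap.range (hardyEmbedding m).toLinearMap := by
  refine HasSum.mem_submodule isClosed_range_hardyEmbedding
    ((bilateralShift (EuclideanSpace ℂ (Fin m))).hasSum (hasSum_hardyEmbedding f)) fun n => ?_
  rw [bilateralShift_trigIsometry]
  exact trigIsometry_mem_range (by positivity) _

lemma exists_eq_bilateralShift (f : HardyTwo m) (hf : f 0 = 0) :
    ∃ y ∈ LinearMap.range (hardyEmbedding m).toLinearMap,
      hardyEmbedding m f = bilateralShift (EuclideanSpace ℂ (Fin m)) y := by
  refine ⟨star (bilateralShift (EuclideanSpace ℂ (Fin m))) (hardyEmbedding m f), ?_, ?_⟩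
  · refine HasSum.mem_submodule isClosed_range_hardyEmbedding
      ((star (bilateralShift (EuclideanSpace ℂ (Fin m)))).hasSum
        (hasSum_hardyEmbedding f)) fun n => ?_
    rw [star_bilateralShift_trigIsometry]
    rcases n with _ | n
    · rw [hf, map_zero]
      exact Submodule.zero_mem _
    · exact trigIsometry_mem_range (by push_cast; omega) _
  · rw [← mul_apply_eq_comp,
      (Unitary.mem_iff.1 (bilateralShift_mem_unitary (E := EuclideanSpace ℂ (Fin m)))).2,
      one_apply_eq_self]

lemma eq_zero_of_forall_bilateralShift_pow (x : CircleL2 (EuclideanSpace ℂ (Fin m)))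
    (hx : ∀ k : ℕ, ∃ y ∈ LinearMap.range (hardyEmbedding m).toLinearMap,
      x = (bilateralShift (EuclideanSpace ℂ (Fin m)) ^ k) y) : x = 0 := by
  obtain ⟨_, ⟨f, rfl⟩, hf⟩ := hx 0
  rw [pow_zero, one_apply_eq_self, LinearIsometry.coe_toLinearMap] at hf
  have hf0 : f = 0 := by
    ext1
    funext n
    refine ext_inner_left ℂ fun (v : EuclideanSpace ℂ (Fin m)) => ?_
    refine (inner_trigIsometry_hardyEmbedding n v f).symm.trans ?_
    obtain ⟨_, ⟨g, rfl⟩, hg⟩ := hx (n + 1)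
    have h1 : trigIsometry (n : ℤ) v =
        (bilateralShift (EuclideanSpace ℂ (Fin m)) ^ (n + 1)) (trigIsometry (-1) v) := by
      rw [bilateralShift_pow_trigIsometry,
        show (-1 : ℤ) + ((n + 1 : ℕ) : ℤ) = n by push_cast; ring]
    rw [← hf, hg, h1, inner_map_unitary (pow_mem bilateralShift_mem_unitary _)]
    exact (inner_trigIsometry_hardyEmbedding_of_neg (by norm_num) v g).trans
      (inner_zero_right _).symm
  rw [hf, hf0, map_zero]

lemma HardyTwo.eval_zero_eq (f : HardyTwo m) : f.eval 0 = f 0 := by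
  rw [HardyTwo.eval, tsum_eq_single 0]
  · simp
  · intro n hn
    simp [hn]

lemma eval_zero_aeval_toeplitz (hF : IsHInf F) (p : ℂ[X]) (f : HardyTwo m) :
    (aeval (toeplitz F hF) p f).eval 0 =
      aeval (Matrix.toEuclideanCLM (n := Fin m) (𝕜 := ℂ) (F 0)) p (f.eval 0) := by
  have h0 : (0 : ℂ) ∈ Metric.ball (0 : ℂ) 1 := by simp
  have hpow : ∀ n : ℕ, ((toeplitz F hF ^ n) f).eval 0 =
      (Matrix.toEuclideanCLM (n := Fin m) (𝕜 := ℂ) (F 0) ^ n) (f.eval 0) := by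
    intro n
    induction n with
    | zero => simp
    | succ n ih => rw [pow_succ', pow_succ', mul_apply_eq_comp, mul_apply_eq_comp,
        toeplitz_eval_clm hF _ h0, ih]
  change HardyTwo.evalLinear h0 _ = _
  simp only [aeval_eq_sum_range, sum_apply, map_sum, smul_apply, map_smul]
  exact Finset.sum_congr rfl fun n _ => congrArg _ (hpow n)

/-- `p(T_F)` maps `H²_m` to functions vanishing at the origin, for the characteristic polynomial `p`
of `F(0)`. -/
lemma aeval_charpoly_toeplitz_apply_zero (hF : IsHInf F) (f : HardyTwo m) :
    aeval (toeplitz F hF) (F 0).charpoly f 0 = 0 := by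
  rw [← HardyTwo.eval_zero_eq, eval_zero_aeval_toeplitz, Polynomial.aeval_algHom_apply,
    Matrix.aeval_self_charpoly, map_zero]
  rfl

lemma aeval_mulOp_hardyEmbedding (hF : IsHInf F) (hA : HasCoeffs F A)
    (hs : Summable fun n => ‖A n‖) (p : ℂ[X]) (f : HardyTwo m) :
    aeval (mulOp (boundary A hs)) p (hardyEmbedding m f) =
      hardyEmbedding m (aeval (toeplitz F hF) p f) := by
  have hpow : ∀ n : ℕ, (mulOp (boundary A hs) ^ n) (hardyEmbedding m f) =
      hardyEmbedding m ((toeplitz F hF ^ n) f) := by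
    intro n
    induction n with
    | zero => simp
    | succ n ih => rw [pow_succ', pow_succ', mul_apply_eq_comp, mul_apply_eq_comp, ih,
        mulOp_boundary_hardyEmbedding hF hA]
  simp only [aeval_eq_sum_range, sum_apply, map_sum, smul_apply, map_smul, hpow]

/-- A subnormal analytic Toeplitz operator without point masses is pure. -/
lemma isPure_toeplitz (hF : IsHInf F) (hA : HasCoeffs F A) (hs : Summable fun n => ‖A n‖)
    (hb : ∀ t, IsStarNormal (boundary A hs t))
    (hinj : ∀ (c : ℂ) (x : CircleL2 (EuclideanSpace ℂ (Fin m))),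
      mulOp (boundary A hs) x = c • x → x = 0) : IsPure (toeplitz F hF) := by
  intro L _ R hR hRn
  have hN := isStarNormal_mulOp_boundary hs hb
  rw [Submodule.eq_bot_iff]
  intro x hx
  have horbit : ∀ k : ℕ, (star (mulOp (boundary A hs)) ^ k) (hardyEmbedding m x) =
      hardyEmbedding m ((star R ^ k) ⟨x, hx⟩ : L) := by
    intro k
    induction k with
    | zero => simp
    | succ k ih =>
      rw [pow_succ', pow_succ', mul_apply_eq_comp, mul_apply_eq_comp, ih]
      exact adjoint_normalExtension_apply hN (mulOp_boundary_hardyEmbedding hF hA hs) hR hRn _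
  have h0 : hardyEmbedding m x = 0 := by
    refine eq_zero_of_adjoint_orbit_mem hN bilateralShift_mem_unitary
      (commute_bilateralShift_mulOp _) hinj isClosed_range_hardyEmbedding ?_
      (F 0).charpoly_monic.ne_zero ?_ eq_zero_of_forall_bilateralShift_pow
      fun k => ⟨_, (horbit k).symm⟩
    · rintro _ ⟨f, rfl⟩
      exact bilateralShift_hardyEmbedding_mem f
    · rintro _ ⟨f, rfl⟩
      rw [LinearIsometry.coe_toLinearMap, aeval_mulOp_hardyEmbedding hF hA hs]
      exact exists_eq_bilateralShift _ (aeval_charpoly_toeplitz_apply_zero hF f)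
  exact (map_eq_zero_iff _ (hardyEmbedding m).injective).1 h0

end NormalExtension

/-! ### The self-commutator for a rational normal symbol -/

section SelfCommutator

open Polynomial

attribute [local instance] fact_two_pi_pos

lemma selfCommutator_apply_eq_zero {H K : Type*} [NormedAddCommGroup H] [InnerProductSpace ℂ H]
    [CompleteSpace H] [NormedAddCommGroup K] [InnerProductSpace ℂ K] [CompleteSpace K]
    {S : H →L[ℂ] H} {J : H →ₗᵢ[ℂ] K} {N : K →L[ℂ] K} (hN : IsStarNormal N)
    (hJ : ∀ x, N (J x) = J (S x)) {x u : H} (hx : star N (J x) = J u) :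
    selfCommutator S x = 0 := by
  refine ext_inner_right ℂ fun y => ?_
  have h1 : ContinuousLinearMap.adjoint S x = u := by
    refine ext_inner_right ℂ fun y => ?_
    rw [ContinuousLinearMap.adjoint_inner_left, ← J.inner_map_map, ← hJ,
      ← ContinuousLinearMap.adjoint_inner_left, ← ContinuousLinearMap.star_eq_adjoint, hx,
      J.inner_map_map]
  rw [inner_selfCommutator, h1, ContinuousLinearMap.adjoint_inner_right, ← J.inner_map_map,
    ← J.inner_map_map, ← hJ, ← hJ, ← hJ, ← hx, ← ContinuousLinearMap.adjoint_inner_left,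
    ← ContinuousLinearMap.star_eq_adjoint, ← mul_apply_eq_comp, ← mul_apply_eq_comp,
    hN.star_comm_self.eq, sub_self, inner_zero_left]

variable {m : ℕ} {F : ℂ → Matrix (Fin m) (Fin m) ℂ}
  {A : ℕ → EuclideanSpace ℂ (Fin m) →L[ℂ] EuclideanSpace ℂ (Fin m)}

lemma IsFraction.exists_sum_boundary {q : ℂ[X]} {P : Matrix (Fin m) (Fin m) ℂ[X]}
    (h : IsFraction F q P) (hA : HasCoeffs F A) (hs : Summable fun n => ‖A n‖) :
    ∃ (e : ℕ) (B : ℕ → EuclideanSpace ℂ (Fin m) →L[ℂ] EuclideanSpace ℂ (Fin m)),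
      q.natDegree ≤ e ∧ ∀ t, q.eval (fourier 1 t : ℂ) • boundary A hs t =
        ∑ s ∈ Finset.range (e + 1), (fourier s t : ℂ) • B s := by
  let D := ∑ i, ∑ j, (P i j).natDegree
  have hD : ∀ i j, (P i j).natDegree ≤ D := fun i j =>
    (Finset.single_le_sum (f := fun j => (P i j).natDegree) (fun _ _ => Nat.zero_le _)
      (Finset.mem_univ j)).trans
    (Finset.single_le_sum (f := fun i => ∑ j, (P i j).natDegree) (fun _ _ => Nat.zero_le _)
      (Finset.mem_univ i))
  refine ⟨q.natDegree + D,
    fun s => toEuclideanCLE m (Matrix.of fun i j => (P i j).coeff s), by omega, fun t => ?_⟩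
  rw [h.boundary_eq hA hs t]
  simp only [← map_smul, ← map_sum]
  congr 1
  ext i j
  have := hD i j
  rw [Matrix.map_apply, coe_evalRingHom,
    eval_eq_sum_range' (show (P i j).natDegree < q.natDegree + D + 1 by omega), Matrix.sum_apply]
  refine Finset.sum_congr rfl fun s _ => ?_
  rw [Matrix.smul_apply, Matrix.of_apply, smul_eq_mul, ← fourier_one_pow, mul_comm]

lemma fourier_add_sub (j e s : ℕ) (hs : s ≤ e) (t : CircleGroup) :
    (fourier ((j + e - s : ℕ) : ℤ) t : ℂ) =
      fourier ((j + e : ℕ) : ℤ) t * (starRingEnd ℂ) (fourier s t : ℂ) := by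
  rw [← fourier_neg, ← fourier_add]
  congr 2
  omega

/-- A linear recurrence for the columns of the self-commutator. -/
lemma IsFraction.exists_recurrence {q : ℂ[X]} {P : Matrix (Fin m) (Fin m) ℂ[X]}
    (h : IsFraction F q P) (hF : IsHInf F) (hA : HasCoeffs F A) (hs : Summable fun n => ‖A n‖)
    (hb : ∀ t, IsStarNormal (boundary A hs t)) :
    ∃ e : ℕ, q.natDegree ≤ e ∧ ∀ (j : ℕ) (v : EuclideanSpace ℂ (Fin m)),
      ∑ s ∈ Finset.range (e + 1), (starRingEnd ℂ) (q.coeff s) •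
        selfCommutator (toeplitz F hF) (lp.single 2 (j + e - s) v) = 0 := by
  obtain ⟨e, B, hqe, hB⟩ := h.exists_sum_boundary hA hs
  refine ⟨e, hqe, fun j v => ?_⟩
  let x : HardyTwo m := ∑ s ∈ Finset.range (e + 1), (starRingEnd ℂ) (q.coeff s) •
    lp.single 2 (j + e - s) v
  let u : HardyTwo m := ∑ s ∈ Finset.range (e + 1),
    lp.single 2 (j + e - s) (ContinuousLinearMap.adjoint (B s) v)
  have hx : star (mulOp (boundary A hs)) (hardyEmbedding m x) = hardyEmbedding m u := by
    simp only [x, u, map_sum, map_smul, hardyEmbedding_single]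
    simp only [trigIsometry_apply, ← map_smul, ← map_sum, star_mulOp]
    refine mulOp_contToL2 _ _ _ fun t => ?_
    have h1 : (∑ s ∈ Finset.range (e + 1), (starRingEnd ℂ) (q.coeff s) •
        trigMonomial ((j + e - s : ℕ) : ℤ) v) t =
        (fourier ((j + e : ℕ) : ℤ) t * (starRingEnd ℂ) (q.eval (fourier 1 t : ℂ)) : ℂ) • v := by
      rw [ContinuousMap.sum_apply, eval_eq_sum_range' (Nat.lt_succ_of_le hqe), map_sum,
        Finset.mul_sum, Finset.sum_smul]
      refine Finset.sum_congr rfl fun s hs' => ?_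
      rw [ContinuousMap.smul_apply, trigMonomial_apply, smul_smul, fourier_add_sub _ _ _
        (Nat.lt_succ_iff.1 (Finset.mem_range.1 hs')), map_mul, fourier_one_pow]
      congr 1
      ring
    have h2 : (∑ s ∈ Finset.range (e + 1),
        trigMonomial ((j + e - s : ℕ) : ℤ) (ContinuousLinearMap.adjoint (B s) v)) t =
        (fourier ((j + e : ℕ) : ℤ) t : ℂ) •
          ContinuousLinearMap.adjoint (q.eval (fourier 1 t : ℂ) • boundary A hs t) v := by
      rw [ContinuousMap.sum_apply, hB, map_sum, sum_apply, Finset.smul_sum]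
      refine Finset.sum_congr rfl fun s hs' => ?_
      rw [trigMonomial_apply, fourier_add_sub _ _ _
        (Nat.lt_succ_iff.1 (Finset.mem_range.1 hs')), map_smulₛₗ, smul_apply, smul_smul]
    rw [h1, h2, map_smulₛₗ, map_smul, smul_apply, smul_smul]
    rfl
  have h0 := selfCommutator_apply_eq_zero (isStarNormal_mulOp_boundary hs hb)
    (mulOp_boundary_hardyEmbedding hF hA hs) hx
  simpa only [x, map_sum, map_smul] using h0

/-- The self-commutator of a Toeplitz operator with rational normal symbol has finite rank. -/
lemma IsFraction.finiteDimensional_range {q : ℂ[X]} {P : Matrix (Fin m) (Fin m) ℂ[X]}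
    (h : IsFraction F q P) (hF : IsHInf F) (hA : HasCoeffs F A) (hs : Summable fun n => ‖A n‖)
    (hb : ∀ t, IsStarNormal (boundary A hs t)) :
    FiniteDimensional ℂ (LinearMap.range
      (selfCommutator (toeplitz F hF) : HardyTwo m →ₗ[ℂ] HardyTwo m)) := by
  obtain ⟨e, hqe, hrec⟩ := h.exists_recurrence hF hA hs hb
  set C := selfCommutator (toeplitz F hF)
  let W : Submodule ℂ (HardyTwo m) := ⨆ l : Fin e, LinearMap.range
    ((C : HardyTwo m →ₗ[ℂ] HardyTwo m) ∘ₗ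
      lp.lsingle (𝕜 := ℂ) (E := fun _ : ℕ => EuclideanSpace ℂ (Fin m)) 2 (l : ℕ))
  have hW : ∀ (l : ℕ) (v : EuclideanSpace ℂ (Fin m)), C (lp.single 2 l v) ∈ W := by
    intro l
    induction l using Nat.strong_induction_on with
    | _ l ih =>
      intro v
      rcases lt_or_ge l e with hl | hl
      · exact Submodule.mem_iSup_of_mem (⟨l, hl⟩ : Fin e) ⟨v, rfl⟩
      · set s₀ := q.natTrailingDegree
        have hs₀ : s₀ ≤ e := q.natTrailingDegree_le_natDegree.trans hqe
        have hne : (starRingEnd ℂ) (q.coeff s₀) ≠ 0 := by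
          rw [ne_eq, map_eq_zero]
          exact trailingCoeff_nonzero_iff_nonzero.2 h.1
        have h1 := hrec (l - e + s₀) v
        rw [← Finset.add_sum_erase _ _ (Finset.mem_range.2 (Nat.lt_succ_of_le hs₀)),
          show l - e + s₀ + e - s₀ = l by omega] at h1
        refine (W.smul_mem_iff hne).1 ?_
        rw [eq_neg_of_add_eq_zero_left h1]
        refine W.neg_mem (W.sum_mem fun s hs' => ?_)
        rw [Finset.mem_erase, Finset.mem_range] at hs'
        rcases lt_or_ge s s₀ with hlt | hge
        · rw [coeff_eq_zero_of_lt_natTrailingDegree hlt, map_zero, zero_smul]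
          exact W.zero_mem
        · exact W.smul_mem _ (ih _ (by omega) v)
  have hle : LinearMap.range (C : HardyTwo m →ₗ[ℂ] HardyTwo m) ≤ W := by
    rintro _ ⟨f, rfl⟩
    exact HasSum.mem_submodule (Submodule.closed_of_finiteDimensional W)
      (C.hasSum (lp.hasSum_single (E := fun _ : ℕ => EuclideanSpace ℂ (Fin m)) (p := 2)
        (by simp) f)) fun n => hW n _
  exact Submodule.finiteDimensional_of_le hle

end SelfCommutator

/-! ### Normality of the symbol -/

section Normality

attribute [local instance] fact_two_pi_pos

variable {m : ℕ} {F : ℂ → Matrix (Fin m) (Fin m) ℂ}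
  {A : ℕ → EuclideanSpace ℂ (Fin m) →L[ℂ] EuclideanSpace ℂ (Fin m)}

lemma inner_mulOp_trigIsometry {E : Type*} [NormedAddCommGroup E] [InnerProductSpace ℂ E]
    (Ψ : C(CircleGroup, E →L[ℂ] E)) (d : ℤ) (v w : E) :
    ⟪mulOp Ψ (trigIsometry 0 v), mulOp Ψ (trigIsometry d w)⟫_ℂ =
      ∫ t, (fourier d t : ℂ) * ⟪Ψ t v, Ψ t w⟫_ℂ
        ∂(AddCircle.haarAddCircle (T := 2 * Real.pi)) := by
  have h : ∀ (k : ℤ) (u : E), mulOp Ψ (trigIsometry k u) = contToL2 E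
      ⟨fun t => Ψ t (trigMonomial k u t), Ψ.continuous.clm_apply (trigMonomial k u).continuous⟩ :=
    fun k u => mulOp_contToL2 _ _ _ fun t => rfl
  rw [h, h, inner_contToL2]
  refine integral_congr_ae (Eventually.of_forall fun t => ?_)
  simp only [ContinuousMap.coe_mk, trigMonomial_apply, map_smul, fourier_zero, one_smul,
    inner_smul_right]

lemma inner_trigIsometry_star_mulOp (hs : Summable fun n => ‖A n‖) (l : ℕ)
    (v u : EuclideanSpace ℂ (Fin m)) :
    ⟪trigIsometry (-(l : ℤ)) u, star (mulOp (boundary A hs)) (trigIsometry 0 v)⟫_ℂ =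
      ⟪u, ContinuousLinearMap.adjoint (A l) v⟫_ℂ := by
  have h := (innerSL ℂ (trigIsometry (-(l : ℤ)) u)).hasSum (hasSum_star_mulOp_boundary hs 0 v)
  simp only [innerSL_apply_apply, inner_trigIsometry] at h
  refine h.unique ?_
  convert! hasSum_ite_eq l (⟪u, ContinuousLinearMap.adjoint (A l) v⟫_ℂ) using 2 with n
  by_cases hn : n = l
  · subst hn
    simp
  · rw [if_neg hn, if_neg (by omega)]

lemma inner_trigIsometry_star_mulOp_of_pos (hs : Summable fun n => ‖A n‖) {k : ℤ} (hk : 0 < k)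
    (v u : EuclideanSpace ℂ (Fin m)) :
    ⟪trigIsometry k u, star (mulOp (boundary A hs)) (trigIsometry 0 v)⟫_ℂ = 0 := by
  have h := (innerSL ℂ (trigIsometry k u)).hasSum (hasSum_star_mulOp_boundary hs 0 v)
  refine h.unique ?_
  convert! hasSum_zero using 2 with n
  simp only [innerSL_apply_apply]
  rw [inner_trigIsometry, if_neg (by omega)]

lemma hasSum_inner_star_mulOp (hs : Summable fun n => ‖A n‖) (d : ℕ)
    (v w : EuclideanSpace ℂ (Fin m)) :
    HasSum (fun n => ⟪ContinuousLinearMap.adjoint (A n) v,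
        ContinuousLinearMap.adjoint (A (n + d)) w⟫_ℂ)
      ⟪star (mulOp (boundary A hs)) (trigIsometry 0 v),
        star (mulOp (boundary A hs)) (trigIsometry (d : ℤ) w)⟫_ℂ := by
  have h := (innerSL ℂ (star (mulOp (boundary A hs)) (trigIsometry 0 v))).hasSum
    (hasSum_star_mulOp_boundary hs d w)
  rw [← (add_left_injective d).hasSum_iff] at h
  · refine h.congr_fun fun n => ?_
    simp only [Function.comp_apply, innerSL_apply_apply]
    rw [show (d : ℤ) - ((n + d : ℕ) : ℤ) = -(n : ℤ) by push_cast; ring, ← inner_conj_symm,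
      ← inner_conj_symm (star (mulOp (boundary A hs)) (trigIsometry 0 v)),
      inner_trigIsometry_star_mulOp]
  · intro n hn
    rw [innerSL_apply_apply, ← inner_conj_symm, inner_trigIsometry_star_mulOp_of_pos, map_zero]
    by_contra hle
    exact hn ⟨n - d, Nat.sub_add_cancel (by omega)⟩

/-- The difference `⟨Φ(t)* v, Φ(t)* w⟩ - ⟨Φ(t) v, Φ(t) w⟩` for the boundary function `Φ`. -/
def normalityDefect (A : ℕ → EuclideanSpace ℂ (Fin m) →L[ℂ] EuclideanSpace ℂ (Fin m))
    (hs : Summable fun n => ‖A n‖) (v w : EuclideanSpace ℂ (Fin m)) : C(CircleGroup, ℂ) :=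
  ⟨fun t => ⟪star (boundary A hs) t v, star (boundary A hs) t w⟫_ℂ -
      ⟪boundary A hs t v, boundary A hs t w⟫_ℂ,
    (((star (boundary A hs)).continuous.clm_apply continuous_const).inner
      ((star (boundary A hs)).continuous.clm_apply continuous_const)).sub
      (((boundary A hs).continuous.clm_apply continuous_const).inner
        ((boundary A hs).continuous.clm_apply continuous_const))⟩

lemma normalityDefect_apply (hs : Summable fun n => ‖A n‖) (v w : EuclideanSpace ℂ (Fin m))
    (t : CircleGroup) : normalityDefect A hs v w t =
      ⟪star (boundary A hs) t v, star (boundary A hs) t w⟫_ℂ -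
        ⟪boundary A hs t v, boundary A hs t w⟫_ℂ := rfl

lemma integral_fourier_mul_normalityDefect (hF : IsHInf F) (hA : HasCoeffs F A)
    (hs : Summable fun n => ‖A n‖) (hN : CoeffsNormal F hF A) (d : ℕ)
    (v w : EuclideanSpace ℂ (Fin m)) :
    ∫ t, (fourier (d : ℤ) t : ℂ) * normalityDefect A hs v w t
      ∂(AddCircle.haarAddCircle (T := 2 * Real.pi)) = 0 := by
  have hint : ∀ Ψ : C(CircleGroup, EuclideanSpace ℂ (Fin m) →L[ℂ] EuclideanSpace ℂ (Fin m)),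
      Integrable (fun t => (fourier (d : ℤ) t : ℂ) * ⟪Ψ t v, Ψ t w⟫_ℂ)
        (AddCircle.haarAddCircle (T := 2 * Real.pi)) := fun Ψ =>
    (((fourier (d : ℤ)).continuous).mul ((Ψ.continuous.clm_apply continuous_const).inner
      (Ψ.continuous.clm_apply continuous_const))).integrable_of_hasCompactSupport
      (HasCompactSupport.of_compactSpace _)
  simp only [normalityDefect_apply, mul_sub]
  rw [integral_sub (hint (star (boundary A hs))) (hint (boundary A hs)),
    ← inner_mulOp_trigIsometry, ← inner_mulOp_trigIsometry, ← star_mulOp,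
    (hasSum_inner_star_mulOp hs d v w).unique (hN d v w)]
  have h0 : (trigIsometry 0 v : CircleL2 (EuclideanSpace ℂ (Fin m))) =
      hardyEmbedding m (lp.single 2 0 v) := by rw [hardyEmbedding_single]; rfl
  rw [h0, ← hardyEmbedding_single d w, mulOp_boundary_hardyEmbedding hF hA hs,
    mulOp_boundary_hardyEmbedding hF hA hs, LinearIsometry.inner_map_map, sub_self]

lemma fourierCoeff_normalityDefect (hF : IsHInf F) (hA : HasCoeffs F A)
    (hs : Summable fun n => ‖A n‖) (hN : CoeffsNormal F hF A) (v w : EuclideanSpace ℂ (Fin m))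
    (n : ℤ) : fourierCoeff (normalityDefect A hs v w) n = 0 := by
  rw [fourierCoeff]
  simp only [smul_eq_mul]
  rcases le_total 0 (-n) with h | h
  · lift -n to ℕ using h with d
    exact integral_fourier_mul_normalityDefect hF hA hs hN d v w
  · have h1 : ∀ t, (fourier (-n) t : ℂ) * normalityDefect A hs v w t =
        (starRingEnd ℂ) ((fourier n t : ℂ) * normalityDefect A hs w v t) := fun t => by
      rw [fourier_neg, map_mul, normalityDefect_apply, normalityDefect_apply, map_sub,
        inner_conj_symm, inner_conj_symm]
    simp only [h1]
    rw [integral_conj]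
    obtain ⟨d, rfl⟩ := Int.eq_ofNat_of_zero_le (show 0 ≤ n by omega)
    rw [integral_fourier_mul_normalityDefect hF hA hs hN d w v, map_zero]

lemma isStarNormal_boundary (hF : IsHInf F) (hA : HasCoeffs F A)
    (hs : Summable fun n => ‖A n‖) (hN : CoeffsNormal F hF A) (t : CircleGroup) :
    IsStarNormal (boundary A hs t) := by
  rw [ContinuousLinearMap.isStarNormal_iff_norm_eq_adjoint]
  intro v
  have h0 : fourierCoeff (normalityDefect A hs v v) = 0 :=
    funext fun n => fourierCoeff_normalityDefect hF hA hs hN v v n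
  have h1 : HasSum _ (normalityDefect A hs v v) :=
    hasSum_fourier_series_of_summable (by rw [h0]; exact summable_zero)
  simp only [h0, Pi.zero_apply, zero_smul] at h1
  have h2 : normalityDefect A hs v v t = 0 := by rw [h1.unique hasSum_zero]; rfl
  rw [normalityDefect_apply, sub_eq_zero, inner_self_eq_norm_sq_to_K,
    inner_self_eq_norm_sq_to_K] at h2
  have h3 : ‖star (boundary A hs) t v‖ ^ 2 = ‖boundary A hs t v‖ ^ 2 := by exact_mod_cast h2
  exact ((sq_eq_sq₀ (norm_nonneg _) (norm_nonneg _)).1 h3).symm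

end Normality

end

theorem lemma4 (m : ℕ) (hm : 1 ≤ m) (F : ℂ → Matrix (Fin m) (Fin m) ℂ) (hF : IsHInf F) :
    (IsSubnormalOfFiniteType (toeplitz F hF) ∧ HasNoPointMasses (toeplitz F hF)) ↔ IsNDARN F := by
  have hA := hF.hasCoeffs
  constructor
  · rintro ⟨⟨-, -, hfin⟩, K, _, _, _, J, N, ⟨-, hNJ⟩, hinj⟩
    have hR := isRationalMatrix_of_finiteRank hF hA
    obtain ⟨q, P, h⟩ := hF.exists_isFraction hR
    have hs := h.summable_matrixCoeff hF
    refine ⟨fun c => ?_, hF, hR, ?_⟩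
    · by_contra! hdet
      obtain ⟨x, hx, hTx⟩ := h.exists_eigenvector hF hdet
      refine hx ((map_eq_zero_iff J J.injective).1 (hinj c (J x) ?_))
      rw [hNJ, hTx, map_smul]
    · exact (isNormalMatrix_iff hA hs).2
        (isStarNormal_boundary hF hA hs (coeffsNormal_of_finiteRank hF hA))
  · rintro ⟨hnd, -, hR, hnor⟩
    obtain ⟨q, P, h⟩ := hF.exists_isFraction hR
    have hs := h.summable_matrixCoeff hF
    have hb := (isNormalMatrix_iff hA hs).1 hnor
    have hinj := mulOp_boundary_no_eigenvector h hF hA hs hnd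
    have hext : IsNormalExtension (toeplitz F hF) (hardyEmbedding m)
        (mulOp (boundary (matrixCoeff F) hs)) :=
      ⟨isStarNormal_mulOp_boundary hs hb, mulOp_boundary_hardyEmbedding hF hA hs⟩
    exact ⟨⟨⟨_, _, _, inferInstance, _, _, hext⟩, isPure_toeplitz hF hA hs hb hinj,
      h.finiteDimensional_range hF hA hs hb⟩, _, _, _, inferInstance, _, _, hext, hinj⟩
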